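/- **Lemma (Completeness).** *Every deterministic first-order grammar in normal form has a sufficient basis.* *Terms.* Let $\mathcal N$ be a finite set of nonterminals with arities and $x_1,x_2,\dots$ variables (of arity $0$). A term is a finite or infinite tree over these symbols whose nodes have as many ordered successors as the arity of their label; it is *regular* if it has only finitely many distinct subterms, and *ground* if no variable occurs in it. Only regular terms are considered. $E(x_1,\dots,x_n)$ indicates that all variables of $E$ are among $x_1,\dots,x_n$, and $E(G_1,\dots,G_n)=E[G_1/x_1,\dots,G_n/x_n]$. For $F=F(x_1)$, the term $F^{\lim}=F[F/x_1]^{\omega}$ is obtained from $F$, seen as a labelled graph, by redirecting each edge leading to a node labelled $x_1$ to the root. *Grammars.* A first-order grammar $\mathcal G=(\mathcal N,\mathcal A,\mathcal R)$ has a finite set $\mathcal A$ of actions and a finite set $\mathcal R$ of rules $Xx_1\dots x_m\xrightarrow{a}E(x_1,\dots,x_m)$, where $a\in\mathcal A$, $m=\mathrm{arity}(X)$ and $E$ is a finite term. It generates the transitions $XG_1\dots G_m\xrightarrow{a}E(G_1,\dots,G_m)$ between regular terms, which extend to words $w\in\mathcal A^*$ as usual. It is *deterministic* if for each $X,a$ there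 is at most one rule, and in *normal form* if for all $X\in\mathcal N$ and $1\le i\le\mathrm{arity}(X)$ there is a word $w$ with $Xx_1\dots x_m\xrightarrow{w}x_i$. Write $T\sim U$ if $T,U$ enable the same words, and $T\sim_1U$ if they enable the same words of length at most $1$. *Derivation system.* Let $\mathcal B$ be a set of pairs of regular terms. A *ground instance* of $(E,F)$ is a pair $(E\sigma,F\sigma)$ where $\sigma$ replaces the variables by ground terms; $\mathcal B$ is *sound* if $T\sim U$ for every ground instance $(T,U)$ of a pair in $\mathcal B$. For regular ground terms $T_0,U_0$, the relation $\models\,=\,\models_{(T_0,U_0)}$ between words and labels (a label is a pair of regular ground terms, or $\mathrm{success}$, or $\mathrm{fail}$) is the least one such that: 0. $\varepsilon\models(T_0,U_0)$; 1. if $u\models(T,U)$, $T\sim_1U$, $T\xrightarrow{a}T'$ and $U\xrightarrow{a}U'$, then $ua\models(T',U')$; 2. if $u\models(E(T),U)$, $|v|<|u|$, $v\models(T,F(T))$ and $F\neq x_1$, where $E=E(x_1)$ and $F=F(x_1)$ are regular terms, then $u\models(E(F^{\lim}),U)$; 3. if $u\models(T,U)$ then $u\models(U,T)$; 4. if $u\ne\varepsilon$,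 $u\models(T,U)$ and $(T,U)$ is a ground instance of a pair in $\mathcal B$, then $u\models\mathrm{success}$; 5. if $u\models(T,U)$, $T\sim_1U$ and $ua\models\mathrm{success}$ for all $a$ enabled by $T$, then $u\models\mathrm{success}$; 6. if $u\models(T,U)$ and $T\not\sim_1U$, then $\varepsilon\models\mathrm{fail}$. *Claim.* For every deterministic first-order grammar $\mathcal G$ in normal form there is a finite sound set $\mathcal B$ of pairs of regular terms, containing $(x_1,x_1)$, such that for all regular ground terms $T_0,U_0$: if $T_0\sim U_0$, then $\varepsilon\models_{(T_0,U_0)}\mathrm{success}$. -/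

import Mathlib

universe u v

namespace FOG

/-! ### Labelled transition systems and trace equivalence -/

/-- A labelled transition system with states `S` and actions `A`. -/
structure LTS (S : Type u) (A : Type v) where
  step : S → A → S → Prop

namespace LTS

variable {S : Type u} {A : Type v}

/-- `L.Reach s w t`: the state `t` is reachable from `s` by the word `w`. -/
def Reach (L : LTS S A) : S → List A → S → Prop
  | s, [], t => s = t
  | s, a :: w, t => ∃ s₁, L.step s a s₁ ∧ L.Reach s₁ w t

/-- The set of words enabled in `s`. -/
def traces (L : LTS S A) (s : S) : Set (List A) :=
  {w | ∃ t, L.Reach s w t}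

/-- The set of words of length at most `k` enabled in `s`. -/
def tracesUpTo (L : LTS S A) (k : ℕ) (s : S) : Set (List A) :=
  {w | w ∈ L.traces s ∧ w.length ≤ k}

/-- Trace equivalence `r ∼ s`. -/
def TraceEquiv (L : LTS S A) (r s : S) : Prop :=
  L.traces r = L.traces s

/-- The equivalence `r ∼ₖ s`. -/
def TraceEquivUpTo (L : LTS S A) (k : ℕ) (r s : S) : Prop :=
  L.tracesUpTo k r = L.tracesUpTo k s

end LTS

/-! ### Regular terms

A term is a partial map from finite sequences of natural numbers to symbols. A symbol is a
nonterminal `Sum.inl X` or a variable `Sum.inr j`. Successors and variables are numbered from `0`: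
the `(i+1)`-st successor of a node is reached through the index `i`, and `Sum.inr j` is the variable
usually written `x_{j+1}`. -/

/-- A partial map from finite sequences of natural numbers to nonterminals and variables. -/
abbrev Labelling (N : Type u) : Type u := List ℕ → Option (N ⊕ ℕ)

/-- `Labelling.at f γ` is the map `δ ↦ f (γδ)`, the subterm occurring at `γ`. -/
def Labelling.at {N : Type u} (f : Labelling N) (γ : List ℕ) : Labelling N :=
  fun δ => f (γ ++ δ)

/-- Regular (finite or infinite) terms over nonterminals `N` with arities `ar`. The field
`label_concat` says both that the domain is prefix-closed and that a node labelled with `X` has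
exactly the successors `0, …, ar X - 1`, a node labelled with a variable having none. -/
@[ext]
structure RegTerm {N : Type u} (ar : N → ℕ) where
  label : Labelling N
  label_nil : label [] ≠ none
  label_concat : ∀ (γ : List ℕ) (i : ℕ),
    label (γ ++ [i]) ≠ none ↔ ∃ X, label γ = some (Sum.inl X) ∧ i < ar X
  regular : {f : Labelling N | ∃ γ, label γ ≠ none ∧ f = Labelling.at label γ}.Finite

/-- Replace every variable `j` occurring in `f` by `σ j`, and evaluate at the given sequence. -/
def substLabel {N : Type u} (σ : ℕ → Labelling N) : List ℕ → Labelling N → Option (N ⊕ ℕ)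
  | [], f =>
    match f [] with
    | some (Sum.inr j) => σ j []
    | s => s
  | c :: γ, f =>
    match f [] with
    | some (Sum.inr j) => σ j (c :: γ)
    | _ => substLabel σ γ (fun δ => f (c :: δ))

open Classical in
/-- Walk through the current subterm `f` of `h` along the given sequence, where every edge that
leads to a node labelled with the variable `i` is redirected to the root of `h`. -/
noncomputable def limLabel {N : Type u} (i : ℕ) (h : Labelling N) :
    List ℕ → Labelling N → Option (N ⊕ ℕ)
  | [], f => f []
  | c :: γ, f =>
    if f [c] = some (Sum.inr i) then limLabel i h γ h
    else limLabel i h γ (fun δ => f (c :: δ))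

namespace RegTerm

variable {N : Type u} {ar : N → ℕ}

theorem label_eq_none (E : RegTerm ar) (γ δ : List ℕ) (h : E.label γ = none) :
    E.label (γ ++ δ) = none := by
  induction δ using List.reverseRecOn with
  | nil => simpa using h
  | append_singleton δ i ih =>
    by_contra hne
    rw [← List.append_assoc] at hne
    obtain ⟨X, hX, _⟩ := (E.label_concat _ _).1 hne
    simp [ih] at hX

theorem range_finite (E : RegTerm ar) : (Set.range (Labelling.at E.label)).Finite := by
  refine (E.regular.union (Set.finite_singleton (fun _ => none))).subset ?_
  rintro _ ⟨γ, rfl⟩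
  by_cases h : E.label γ = none
  · exact Or.inr (funext fun δ => E.label_eq_none γ δ h)
  · exact Or.inl ⟨γ, h, rfl⟩

theorem regular_of_range {f : Labelling N} (h : (Set.range (Labelling.at f)).Finite) :
    {g : Labelling N | ∃ γ, f γ ≠ none ∧ g = Labelling.at f γ}.Finite :=
  h.subset (by rintro _ ⟨γ, _, rfl⟩; exact ⟨γ, rfl⟩)

/-- The variable `j` as a term. -/
def var (j : ℕ) : RegTerm ar where
  label γ := match γ with
    | [] => some (Sum.inr j)
    | _ :: _ => none
  label_nil := by simp
  label_concat γ i := by cases γ <;> simp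
  regular := by
    refine Set.Finite.subset (Set.finite_singleton
      (fun γ : List ℕ => match γ with
        | [] => some (Sum.inr j)
        | _ :: _ => none)) ?_
    rintro _ ⟨γ, hγ, rfl⟩
    cases γ with
    | nil => rfl
    | cons c γ => simp at hγ

/-- The term `X G₁ … Gₘ` with root nonterminal `X` of arity `m`. -/
def node (X : N) (G : Fin (ar X) → RegTerm ar) : RegTerm ar where
  label γ := match γ with
    | [] => some (Sum.inl X)
    | i :: δ => if h : i < ar X then (G ⟨i, h⟩).label δ else none
  label_nil := by simp
  label_concat γ i := by
    cases γ with
    | nil =>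
      by_cases h : i < ar X
      · simpa [h] using (G ⟨i, h⟩).label_nil
      · simp [h]
    | cons c δ =>
      by_cases h : c < ar X
      · simpa [h] using (G ⟨c, h⟩).label_concat δ i
      · simp [h]
  regular := by
    apply regular_of_range
    refine (((Set.finite_iUnion fun i => (G i).range_finite).union
      (Set.finite_singleton (fun _ => none))).insert (fun γ => match γ with
        | [] => some (Sum.inl X)
        | i :: δ => if h : i < ar X then (G ⟨i, h⟩).label δ else none)).subset ?_
    rintro _ ⟨γ, rfl⟩
    cases γ with
    | nil => exact Or.inl rfl
    | cons c γ =>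
      by_cases h : c < ar X
      · refine Or.inr (Or.inl (Set.mem_iUnion.2 ⟨⟨c, h⟩, γ, ?_⟩))
        funext δ
        simp [Labelling.at, h]
      · refine Or.inr (Or.inr ?_)
        funext δ
        simp [Labelling.at, h]

/-- The term `X x₁ … xₘ`, where `m` is the arity of `X`. -/
def flat (X : N) : RegTerm ar :=
  node X (fun i => var i)

theorem substLabel_concat (σ : ℕ → RegTerm ar) (γ : List ℕ) (i : ℕ) :
    ∀ f : Labelling N,
      (∀ (γ : List ℕ) (i : ℕ),
        f (γ ++ [i]) ≠ none ↔ ∃ X, f γ = some (Sum.inl X) ∧ i < ar X) →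
      (substLabel (fun j => (σ j).label) (γ ++ [i]) f ≠ none ↔
        ∃ X, substLabel (fun j => (σ j).label) γ f = some (Sum.inl X) ∧ i < ar X) := by
  induction γ with
  | nil =>
    intro f hf
    have h1 := hf [] i
    rcases h : f [] with _ | (X | j)
    · rw [h] at h1
      have : f [i] = none := by simpa using h1
      simp [substLabel, h, this]
    · rw [h] at h1
      rcases h2 : f [i] with _ | (Y | j)
      · simpa [substLabel, h, h2] using h1
      · simpa [substLabel, h, h2] using h1
      · have := (σ j).label_nil
        simpa [substLabel, h, h2, this] using h1
    · simpa [substLabel, h] using (σ j).label_concat [] i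
  | cons c γ ih =>
    intro f hf
    have := ih (fun δ => f (c :: δ)) (fun δ k => hf (c :: δ) k)
    rcases h : f [] with _ | (X | j)
    · simpa [substLabel, h] using this
    · simpa [substLabel, h] using this
    · simpa [substLabel, h] using (σ j).label_concat (c :: γ) i

theorem substLabel_at (σ : ℕ → Labelling N) (γ : List ℕ) :
    ∀ f : Labelling N,
      (∃ γ', Labelling.at (fun δ => substLabel σ δ f) γ =
        fun δ => substLabel σ δ (Labelling.at f γ')) ∨
      ∃ j γ₁ γ₂, f γ₁ = some (Sum.inr j) ∧
        Labelling.at (fun δ => substLabel σ δ f) γ = Labelling.at (σ j) γ₂ := by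
  induction γ with
  | nil => exact fun f => Or.inl ⟨[], rfl⟩
  | cons c γ ih =>
    intro f
    by_cases h : ∃ j, f [] = some (Sum.inr j)
    · obtain ⟨j, hj⟩ := h
      refine Or.inr ⟨j, [], c :: γ, hj, ?_⟩
      funext δ
      simp [Labelling.at, substLabel, hj]
    · have key : Labelling.at (fun δ => substLabel σ δ f) (c :: γ) =
          Labelling.at (fun δ => substLabel σ δ (fun δ' => f (c :: δ'))) γ := by
        funext δ
        rcases h' : f [] with _ | (X | j)
        · simp [Labelling.at, substLabel, h']
        · simp [Labelling.at, substLabel, h']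
        · exact absurd ⟨j, h'⟩ h
      rw [key]
      rcases ih (fun δ' => f (c :: δ')) with ⟨γ', h1⟩ | ⟨j, γ₁, γ₂, h1, h2⟩
      · exact Or.inl ⟨c :: γ', h1⟩
      · exact Or.inr ⟨j, c :: γ₁, γ₂, h1, h2⟩

/-- The term `Eσ`. -/
def subst (E : RegTerm ar) (σ : ℕ → RegTerm ar) : RegTerm ar where
  label γ := substLabel (fun j => (σ j).label) γ E.label
  label_nil := by
    rcases h : E.label [] with _ | (X | j)
    · exact absurd h E.label_nil
    · simp [substLabel, h]
    · simpa [substLabel, h] using (σ j).label_nil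
  label_concat γ i := substLabel_concat σ γ i E.label E.label_concat
  regular := by
    apply regular_of_range
    have hvar : {j : ℕ | ∃ γ, E.label γ = some (Sum.inr j)}.Finite := by
      refine Set.Finite.subset ((E.range_finite.image (fun f => f [])).preimage
        (f := fun j : ℕ => (some (Sum.inr j) : Option (N ⊕ ℕ)))
        (fun a _ b _ hab => by simpa using hab)) ?_
      rintro j ⟨γ, hγ⟩
      exact ⟨_, ⟨γ, rfl⟩, by simpa [Labelling.at] using hγ⟩
    refine ((E.range_finite.image
        (fun f δ => substLabel (fun j => (σ j).label) δ f)).union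
      (hvar.biUnion fun j _ => (σ j).range_finite)).subset ?_
    rintro _ ⟨γ, rfl⟩
    rcases substLabel_at (fun j => (σ j).label) γ E.label with
      ⟨γ', h1⟩ | ⟨j, γ₁, γ₂, h1, h2⟩
    · exact Or.inl ⟨_, ⟨γ', rfl⟩, h1.symm⟩
    · refine Or.inr (Set.mem_biUnion (x := j) ⟨γ₁, h1⟩ ⟨γ₂, h2.symm⟩)

theorem limLabel_concat (i : ℕ) (H : RegTerm ar) (γ : List ℕ) (k : ℕ) :
    ∀ f : Labelling N,
      (∀ (γ : List ℕ) (i : ℕ),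
        f (γ ++ [i]) ≠ none ↔ ∃ X, f γ = some (Sum.inl X) ∧ i < ar X) →
      (limLabel i H.label (γ ++ [k]) f ≠ none ↔
        ∃ X, limLabel i H.label γ f = some (Sum.inl X) ∧ k < ar X) := by
  induction γ with
  | nil =>
    intro f hf
    have h1 := hf [] k
    by_cases h : f [k] = some (Sum.inr i)
    · simpa [limLabel, h, H.label_nil] using h1
    · simpa [limLabel, h] using h1
  | cons c γ ih =>
    intro f hf
    by_cases h : f [c] = some (Sum.inr i)
    · simpa [limLabel, h] using ih H.label H.label_concat
    · simpa [limLabel, h] using ih (fun δ => f (c :: δ)) (fun δ k => hf (c :: δ) k)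

theorem limLabel_at (i : ℕ) (h : Labelling N) (γ : List ℕ) :
    ∀ γ₀ : List ℕ, ∃ γ', Labelling.at (fun δ => limLabel i h δ (Labelling.at h γ₀)) γ =
        fun δ => limLabel i h δ (Labelling.at h γ') := by
  induction γ with
  | nil => exact fun γ₀ => ⟨γ₀, rfl⟩
  | cons c γ ih =>
    intro γ₀
    by_cases hc : Labelling.at h γ₀ [c] = some (Sum.inr i)
    · obtain ⟨γ', h'⟩ := ih []
      refine ⟨γ', h'.symm ▸ ?_⟩
      funext δ
      change limLabel i h (c :: (γ ++ δ)) _ = limLabel i h (γ ++ δ) h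
      rw [limLabel, if_pos hc]
    · obtain ⟨γ', h'⟩ := ih (γ₀ ++ [c])
      refine ⟨γ', h'.symm ▸ ?_⟩
      funext δ
      change limLabel i h (c :: (γ ++ δ)) _ = limLabel i h (γ ++ δ) _
      rw [limLabel, if_neg hc]
      congr 1
      funext δ'
      simp [Labelling.at]

/-- The limit substitution `H[H/x_i]^ω`: every edge of `H` (seen as a labelled graph) that leads to
a node labelled with the variable `i` is redirected to the root of `H`. -/
noncomputable def lim (i : ℕ) (H : RegTerm ar) : RegTerm ar where
  label γ := limLabel i H.label γ H.label
  label_nil := by simpa [limLabel] using H.label_nil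
  label_concat γ k := limLabel_concat i H γ k H.label H.label_concat
  regular := by
    apply regular_of_range
    refine (H.range_finite.image (fun f δ => limLabel i H.label δ f)).subset ?_
    rintro _ ⟨γ, rfl⟩
    obtain ⟨γ', h'⟩ := limLabel_at i H.label γ []
    exact ⟨_, ⟨γ', rfl⟩, h'.symm⟩

/-- `E` is a finite term. -/
def IsFinite (E : RegTerm ar) : Prop :=
  {γ | E.label γ ≠ none}.Finite

/-- All variables occurring in `E` are among the first `n` variables, that is,
`E = E(x₁, …, xₙ)`. -/
def VarsBelow (n : ℕ) (E : RegTerm ar) : Prop :=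
  ∀ γ j, E.label γ = some (Sum.inr j) → j < n

/-- `E` is a ground term: no variable occurs in it. -/
def IsGround (E : RegTerm ar) : Prop :=
  ∀ γ j, E.label γ ≠ some (Sum.inr j)

/-- The term `E[T/x₁]`, written `E(T)` when `E = E(x₁)`. -/
def inst (E T : RegTerm ar) : RegTerm ar :=
  E.subst (Function.update var 0 T)

end RegTerm

/-! ### First-order grammars -/

/-- A first-order grammar with nonterminals `N` and actions `A`. The triple `(X, a, E)` in `rules`
is the root rewriting rule `X x₁ … xₘ ⟶ᵃ E(x₁, …, xₘ)`, where `m` is the arity of `X` and `E` is a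
finite term. The sets `N` and `A` are assumed finite where the grammar is used. -/
structure Grammar (N : Type u) (A : Type v) where
  arity : N → ℕ
  rules : Set (N × A × RegTerm arity)
  rules_finite : rules.Finite
  rhs_finite : ∀ X a E, (X, a, E) ∈ rules → E.IsFinite
  rhs_vars : ∀ X a E, (X, a, E) ∈ rules → E.VarsBelow (arity X)

namespace Grammar

variable {N : Type u} {A : Type v}

/-- The terms of the grammar. -/
abbrev Term (G : Grammar N A) : Type u := RegTerm G.arity

/-- For each nonterminal and each action there is at most one rule. -/
def IsDeterministic (G : Grammar N A) : Prop :=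
  ∀ X a E E', (X, a, E) ∈ G.rules → (X, a, E') ∈ G.rules → E = E'

/-- The transition system generated by the grammar: the transitions are
`(X x₁ … xₘ)σ ⟶ᵃ E(x₁, …, xₘ)σ`, for all rules and all substitutions. -/
def lts (G : Grammar N A) : LTS G.Term A where
  step T a T' := ∃ (X : N) (E : G.Term) (σ : ℕ → G.Term),
    (X, a, E) ∈ G.rules ∧ T = (RegTerm.flat X).subst σ ∧ T' = E.subst σ

/-- Normal form: for each nonterminal `X` and each of its successors there is a word exposing
that successor. -/
def IsNormalForm (G : Grammar N A) : Prop :=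
  ∀ (X : N) (i : Fin (G.arity X)),
    ∃ w : List A, G.lts.Reach (RegTerm.flat X) w (RegTerm.var (i : ℕ))

/-- The ground instances of the pairs in `B`. -/
def instances (G : Grammar N A) (B : Set (G.Term × G.Term)) : Set (G.Term × G.Term) :=
  {p | ∃ E F, (E, F) ∈ B ∧ ∃ σ : ℕ → G.Term,
    (∀ j, (σ j).IsGround) ∧ p = (E.subst σ, F.subst σ)}

/-- A set of pairs is sound if all its ground instances are pairs of trace equivalent terms. -/
def IsSound (G : Grammar N A) (B : Set (G.Term × G.Term)) : Prop :=
  ∀ p ∈ G.instances B, G.lts.TraceEquiv p.1 p.2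

/-- The labels of words: pairs of terms, `success`, and `fail`. -/
inductive Label (G : Grammar N A) : Type u
  | pair (T U : G.Term) : Label G
  | success : Label G
  | fail : Label G

/-- The word-labelling predicate `u ⊨ label` for the basis `B` and the initial pair `(T₀, U₀)`. -/
inductive Models (G : Grammar N A) (B : Set (G.Term × G.Term)) (T₀ U₀ : G.Term) :
    List A → G.Label → Prop
  | start : Models G B T₀ U₀ [] (.pair T₀ U₀)
  | basicTransition {u : List A} {a : A} {T U T' U' : G.Term} :
      Models G B T₀ U₀ u (.pair T U) → G.lts.TraceEquivUpTo 1 T U →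
      G.lts.step T a T' → G.lts.step U a U' →
      Models G B T₀ U₀ (u ++ [a]) (.pair T' U')
  | limitReplacement {u w : List A} {E F T U : G.Term} :
      E.VarsBelow 1 → F.VarsBelow 1 →
      Models G B T₀ U₀ u (.pair (E.inst T) U) → w.length < u.length →
      Models G B T₀ U₀ w (.pair T (F.inst T)) → F ≠ RegTerm.var 0 →
      Models G B T₀ U₀ u (.pair (E.inst (F.lim 0)) U)
  | symmetry {u : List A} {T U : G.Term} :
      Models G B T₀ U₀ u (.pair T U) → Models G B T₀ U₀ u (.pair U T)
  | basis {u : List A} {T U : G.Term} :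
      u ≠ [] → Models G B T₀ U₀ u (.pair T U) → (T, U) ∈ G.instances B →
      Models G B T₀ U₀ u .success
  | progression {u : List A} {T U : G.Term} :
      Models G B T₀ U₀ u (.pair T U) → G.lts.TraceEquivUpTo 1 T U →
      (∀ a, (∃ T', G.lts.step T a T') → Models G B T₀ U₀ (u ++ [a]) .success) →
      Models G B T₀ U₀ u .success
  | rejection {u : List A} {T U : G.Term} :
      Models G B T₀ U₀ u (.pair T U) → ¬ G.lts.TraceEquivUpTo 1 T U →
      Models G B T₀ U₀ [] .fail

/-- A sufficient basis: a finite sound set of pairs of regular terms, containing `(x₁, x₁)`, by which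
`ε ⊨ success` is derivable for every pair of trace equivalent regular ground terms. -/
def IsSufficientBasis (G : Grammar N A) (B : Set (G.Term × G.Term)) : Prop :=
  B.Finite ∧ (RegTerm.var 0, RegTerm.var 0) ∈ B ∧ G.IsSound B ∧
    ∀ T₀ U₀ : G.Term, T₀.IsGround → U₀.IsGround → G.lts.TraceEquiv T₀ U₀ →
      G.Models B T₀ U₀ [] .success

end Grammar

end FOG

namespace FOG

/-! ### Regular terms -/

/-! The basis is built so that it catches a pair on every infinite branch that avoids success.
Suppose `T₀ ∼ U₀` but success is not derivable for the empty word. By progression there is an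
infinite enabled word α none of whose prefixes has success (`exists_stuck`); all pairs derived along
it are equivalent. No pair labels two prefixes of α: the earlier occurrence would turn the later
pair into some (U, U), an instance of (x₁, x₁).

Balancing. Fix M such that every root successor can be exposed by fewer than M letters. Let (Z, W)
be derived, and let Z expose no root successor within the next M letters of α before the last one.
Each successor of Z is then paired, at a word shorter than the one M letters later, with a term
reached from W. Replacement yields a pair both of whose sides are built from terms close to the
pivot W, one of them under a small context (`exists_balanced`). If both sides kept sinking to root
successors, they would visit finitely many terms and a pair would repeat; hence pivots recur.
Successive pivots lie on one path, whose labels need not be those of α and which, apart from a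
bounded part after each pivot, sinks until the next one (`exists_next_pivot`, `exists_pivot_path`).

Stairs. Either some position of this path never loses its root, or the path descends forever through
subterms of its first term, one of which recurs. In both cases one ground term V has infinitely many
pivots above its root successors, the j-th at a distance bounded in terms of j and the grammar alone
(`exists_stair`). Cutting V = Pτ at depth M + 1, with P from a finite set, the balanced pairs become
(Eτ, Fτ) with (E, F) in a finite set determined by P and j (`exists_balancedPair`).

Elimination. Given finite sets of pairs over finitely many variables, a finite sound set meets every
such sequence (`exists_sound_covers`). If the first pair is sound, it is taken. If it has an
equivalent instance but is unsound, some word exposes an equation σ(xᵢ) ∼ Hσ, and xᵢ can be replaced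
by the limit of H in later pairs, leaving fewer variables. Nothing here depends on `T₀` and `U₀`, so
the union over the finitely many P, together with (x₁, x₁), is a sufficient basis. -/

theorem substLabel_of_var {N : Type u} (σ : ℕ → Labelling N) {f : Labelling N} {j : ℕ}
    (h : f [] = some (Sum.inr j)) (γ : List ℕ) : substLabel σ γ f = σ j γ := by
  cases γ <;> simp [substLabel, h]

theorem substLabel_nil_of_not_var {N : Type u} (σ : ℕ → Labelling N) {f : Labelling N}
    (h : ∀ j, f [] ≠ some (Sum.inr j)) : substLabel σ [] f = f [] := by
  rcases h' : f [] with _ | (X | j)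
  · simp [substLabel, h']
  · simp [substLabel, h']
  · exact absurd h' (h j)

theorem substLabel_cons_of_not_var {N : Type u} (σ : ℕ → Labelling N) {f : Labelling N}
    (h : ∀ j, f [] ≠ some (Sum.inr j)) (c : ℕ) (γ : List ℕ) :
    substLabel σ (c :: γ) f = substLabel σ γ (fun δ => f (c :: δ)) := by
  rcases h' : f [] with _ | (X | j)
  · simp [substLabel, h']
  · simp [substLabel, h']
  · exact absurd h' (h j)

theorem substLabel_substLabel {N : Type u} (σ τ : ℕ → Labelling N) (γ : List ℕ) :
    ∀ f : Labelling N, substLabel τ γ (fun δ => substLabel σ δ f) =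
      substLabel (fun j δ => substLabel τ δ (σ j)) γ f := by
  induction γ with
  | nil =>
    intro f
    by_cases h : ∃ j, f [] = some (Sum.inr j)
    · obtain ⟨j, hj⟩ := h
      rw [substLabel_of_var _ hj, show (fun δ => substLabel σ δ f) = σ j from
        funext (substLabel_of_var σ hj)]
    · push Not at h
      have h' : ∀ j, (fun δ => substLabel σ δ f) [] ≠ some (Sum.inr j) := by
        simpa [substLabel_nil_of_not_var σ h] using h
      rw [substLabel_nil_of_not_var _ h, substLabel_nil_of_not_var _ h',
        substLabel_nil_of_not_var _ h]
  | cons c γ ih =>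
    intro f
    by_cases h : ∃ j, f [] = some (Sum.inr j)
    · obtain ⟨j, hj⟩ := h
      rw [substLabel_of_var _ hj, show (fun δ => substLabel σ δ f) = σ j from
        funext (substLabel_of_var σ hj)]
    · push Not at h
      have h' : ∀ j, (fun δ => substLabel σ δ f) [] ≠ some (Sum.inr j) := by
        simpa [substLabel_nil_of_not_var σ h] using h
      rw [substLabel_cons_of_not_var _ h, substLabel_cons_of_not_var _ h', ← ih]
      simp only [substLabel_cons_of_not_var _ h]

theorem substLabel_congr {N : Type u} (σ τ : ℕ → Labelling N) (γ : List ℕ) :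
    ∀ f : Labelling N, (∀ δ j, f δ = some (Sum.inr j) → σ j = τ j) →
      substLabel σ γ f = substLabel τ γ f := by
  induction γ with
  | nil =>
    intro f hf
    by_cases h : ∃ j, f [] = some (Sum.inr j)
    · obtain ⟨j, hj⟩ := h
      rw [substLabel_of_var _ hj, substLabel_of_var _ hj, hf _ _ hj]
    · push Not at h
      rw [substLabel_nil_of_not_var _ h, substLabel_nil_of_not_var _ h]
  | cons c γ ih =>
    intro f hf
    by_cases h : ∃ j, f [] = some (Sum.inr j)
    · obtain ⟨j, hj⟩ := h
      rw [substLabel_of_var _ hj, substLabel_of_var _ hj, hf _ _ hj]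
    · push Not at h
      rw [substLabel_cons_of_not_var _ h, substLabel_cons_of_not_var _ h]
      exact ih _ fun δ j hj => hf _ j hj

/-- A symbol of `Eσ` comes either from `E` or from a term substituted for a variable of `E`. -/
theorem substLabel_eq_some {N : Type u} (σ : ℕ → Labelling N) (γ : List ℕ) (s : N ⊕ ℕ) :
    ∀ f : Labelling N, substLabel σ γ f = some s →
      (f γ = some s ∧ ∃ X, s = Sum.inl X) ∨
      ∃ γ₁ γ₂ j, γ = γ₁ ++ γ₂ ∧ f γ₁ = some (Sum.inr j) ∧ σ j γ₂ = some s := by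
  induction γ with
  | nil =>
    intro f hf
    by_cases h : ∃ j, f [] = some (Sum.inr j)
    · obtain ⟨j, hj⟩ := h
      rw [substLabel_of_var _ hj] at hf
      exact Or.inr ⟨[], [], j, rfl, hj, hf⟩
    · push Not at h
      rw [substLabel_nil_of_not_var _ h] at hf
      rcases s with X | j
      · exact Or.inl ⟨hf, X, rfl⟩
      · exact absurd hf (h j)
  | cons c γ ih =>
    intro f hf
    by_cases h : ∃ j, f [] = some (Sum.inr j)
    · obtain ⟨j, hj⟩ := h
      rw [substLabel_of_var _ hj] at hf
      exact Or.inr ⟨[], c :: γ, j, rfl, hj, hf⟩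
    · push Not at h
      rw [substLabel_cons_of_not_var _ h] at hf
      rcases ih _ hf with h1 | ⟨γ₁, γ₂, j, rfl, h1, h2⟩
      · exact Or.inl h1
      · exact Or.inr ⟨c :: γ₁, γ₂, j, rfl, h1, h2⟩

theorem limLabel_of_none {N : Type u} (i : ℕ) (h : Labelling N) (γ : List ℕ) :
    limLabel i h γ (fun _ => none) = none := by
  induction γ with
  | nil => rfl
  | cons c γ ih => simpa [limLabel] using ih

theorem limLabel_eq_var {N : Type u} {i j : ℕ} {D : Set ℕ} {h : Labelling N}
    (h0 : h [] ≠ some (Sum.inr i)) (hD : ∀ δ k, h δ = some (Sum.inr k) → k ∈ D) (γ : List ℕ) :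
    ∀ f : Labelling N, f [] ≠ some (Sum.inr i) → (∀ δ k, f δ = some (Sum.inr k) → k ∈ D) →
      limLabel i h γ f = some (Sum.inr j) → j ∈ D \ {i} := by
  induction γ with
  | nil =>
    intro f hf hfD hj
    refine ⟨hfD _ _ hj, ?_⟩
    rintro rfl
    exact hf hj
  | cons c γ ih =>
    intro f hf hfD hj
    by_cases hc : f [c] = some (Sum.inr i)
    · rw [limLabel, if_pos hc] at hj
      exact ih h h0 hD hj
    · rw [limLabel, if_neg hc] at hj
      exact ih _ hc (fun δ k hk => hfD _ k hk) hj

namespace RegTerm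

variable {N : Type u} {ar : N → ℕ}

theorem subst_subst (E : RegTerm ar) (σ τ : ℕ → RegTerm ar) :
    (E.subst σ).subst τ = E.subst (fun j => (σ j).subst τ) := by
  ext1
  funext γ
  exact substLabel_substLabel _ _ γ _

/-- All variables occurring in `E` belong to `D`. -/
def VarsIn (D : Set ℕ) (E : RegTerm ar) : Prop :=
  ∀ γ j, E.label γ = some (Sum.inr j) → j ∈ D

theorem VarsIn.mono {D D' : Set ℕ} {E : RegTerm ar} (h : E.VarsIn D) (hD : D ⊆ D') :
    E.VarsIn D' := fun γ j hj => hD (h γ j hj)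

theorem IsGround.varsIn {E : RegTerm ar} (h : E.IsGround) (D : Set ℕ) : E.VarsIn D :=
  fun γ j hj => absurd hj (h γ j)

theorem VarsIn.isGround {E : RegTerm ar} (h : E.VarsIn ∅) : E.IsGround :=
  fun γ j hj => h γ j hj

theorem exists_finite_varsIn (E : RegTerm ar) : ∃ D : Set ℕ, D.Finite ∧ E.VarsIn D := by
  refine ⟨{j | ∃ γ, E.label γ = some (Sum.inr j)}, ?_, fun γ j h => ⟨γ, h⟩⟩
  refine Set.Finite.subset ((E.range_finite.image (fun f => f [])).preimage
    (f := fun j : ℕ => (some (Sum.inr j) : Option (N ⊕ ℕ)))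
    (fun a _ b _ hab => by simpa using hab)) ?_
  rintro j ⟨γ, hγ⟩
  exact ⟨_, ⟨γ, rfl⟩, by simpa [Labelling.at] using hγ⟩

theorem subst_congr {D : Set ℕ} {E : RegTerm ar} (hE : E.VarsIn D) {σ τ : ℕ → RegTerm ar}
    (h : ∀ j ∈ D, σ j = τ j) : E.subst σ = E.subst τ := by
  ext1
  funext γ
  exact substLabel_congr _ _ γ _ fun δ j hj => by rw [h j (hE δ j hj)]

@[simp]
theorem var_subst (j : ℕ) (σ : ℕ → RegTerm ar) : (var j : RegTerm ar).subst σ = σ j := by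
  ext1
  funext γ
  exact substLabel_of_var _ rfl γ

theorem label_var (j : ℕ) (γ : List ℕ) (s : N ⊕ ℕ) :
    (var j : RegTerm ar).label γ = some s ↔ γ = [] ∧ s = Sum.inr j := by
  cases γ <;> simp [var, eq_comm]

/-- The `(j+1)`-st successor of the root of `T`, and `T` itself if there is none. -/
noncomputable def child (T : RegTerm ar) (j : ℕ) : RegTerm ar := by
  classical
  exact if h : T.label [j] ≠ none then
    { label := Labelling.at T.label [j]
      label_nil := h
      label_concat := fun γ i => T.label_concat (j :: γ) i
      regular := regular_of_range (T.range_finite.subset (by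
        rintro _ ⟨γ, rfl⟩
        exact ⟨j :: γ, rfl⟩)) }
  else T

theorem child_label {T : RegTerm ar} {j : ℕ} (h : T.label [j] ≠ none) (γ : List ℕ) :
    (T.child j).label γ = T.label (j :: γ) := by
  simp [child, h, Labelling.at]

theorem child_of_none {T : RegTerm ar} {j : ℕ} (h : T.label [j] = none) : T.child j = T := by
  simp [child, h]

theorem child_label_eq (T : RegTerm ar) (j : ℕ) :
    ∃ δ : List ℕ, δ.length ≤ 1 ∧ ∀ γ, (T.child j).label γ = T.label (δ ++ γ) := by
  by_cases h : T.label [j] = none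
  · exact ⟨[], by simp, fun γ => by rw [child_of_none h]; rfl⟩
  · exact ⟨[j], by simp, fun γ => child_label h γ⟩

theorem eq_var_of_label {T : RegTerm ar} {j : ℕ} (h : T.label [] = some (Sum.inr j)) :
    T = var j := by
  ext1
  funext γ
  cases γ with
  | nil => exact h
  | cons c γ =>
    have : T.label [c] = none := by
      by_contra hne
      obtain ⟨X, hX, _⟩ := (T.label_concat [] c).1 hne
      simp [h] at hX
    simpa [var] using T.label_eq_none [c] γ this

theorem exists_label_nil (T : RegTerm ar) :
    (∃ j, T = var j) ∨ ∃ X, T.label [] = some (Sum.inl X) := by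
  rcases h : T.label [] with _ | (X | j)
  · exact absurd h T.label_nil
  · exact Or.inr ⟨X, rfl⟩
  · exact Or.inl ⟨j, eq_var_of_label h⟩

theorem IsGround.exists_label_nil {T : RegTerm ar} (h : T.IsGround) :
    ∃ X, T.label [] = some (Sum.inl X) := by
  rcases T.exists_label_nil with ⟨j, rfl⟩ | h'
  · exact absurd rfl (h [] j)
  · exact h'

theorem label_singleton_ne_none {T : RegTerm ar} {X : N} (h : T.label [] = some (Sum.inl X))
    (j : ℕ) : T.label [j] ≠ none ↔ j < ar X := by
  simpa [h] using T.label_concat [] j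

theorem flat_label_nil (X : N) : (flat X : RegTerm ar).label [] = some (Sum.inl X) := rfl

theorem flat_subst_label_nil (X : N) (σ : ℕ → RegTerm ar) :
    ((flat X).subst σ).label [] = some (Sum.inl X) := rfl

theorem subst_label_nil {E : RegTerm ar} {X : N} (h : E.label [] = some (Sum.inl X))
    (σ : ℕ → RegTerm ar) : (E.subst σ).label [] = some (Sum.inl X) := by
  change substLabel _ _ _ = _
  rw [substLabel_nil_of_not_var _ (by simp [h]), h]

theorem subst_label_cons {E : RegTerm ar} {X : N} (h : E.label [] = some (Sum.inl X))
    (σ : ℕ → RegTerm ar) {c : ℕ} (hc : c < ar X) (γ : List ℕ) :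
    (E.subst σ).label (c :: γ) = ((E.child c).subst σ).label γ := by
  change substLabel _ _ _ = substLabel _ _ _
  rw [substLabel_cons_of_not_var _ (by simp [h])]
  congr 1
  funext δ
  exact (child_label ((label_singleton_ne_none h c).2 hc) δ).symm

theorem child_subst {E : RegTerm ar} {X : N} (h : E.label [] = some (Sum.inl X))
    (σ : ℕ → RegTerm ar) {c : ℕ} (hc : c < ar X) :
    (E.subst σ).child c = (E.child c).subst σ := by
  ext1
  funext γ
  rw [child_label ((label_singleton_ne_none (subst_label_nil h σ) c).2 hc),
    subst_label_cons h σ hc]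

theorem flat_child (X : N) {c : ℕ} (hc : c < ar X) : (flat X : RegTerm ar).child c = var c := by
  ext1
  funext γ
  rw [child_label ((label_singleton_ne_none (flat_label_nil X) c).2 hc)]
  simp [flat, node, hc]

theorem flat_subst_child (X : N) (σ : ℕ → RegTerm ar) {c : ℕ} (hc : c < ar X) :
    ((flat X).subst σ).child c = σ c := by
  rw [child_subst (flat_label_nil X) σ hc, flat_child X hc, var_subst]

theorem label_cons_eq_none {T : RegTerm ar} {X : N} (h : T.label [] = some (Sum.inl X))
    {c : ℕ} (hc : ¬ c < ar X) (γ : List ℕ) : T.label (c :: γ) = none :=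
  T.label_eq_none [c] γ (by
    by_contra hne
    exact hc ((label_singleton_ne_none h c).1 hne))

theorem ext_child {T U : RegTerm ar} {X : N} (hT : T.label [] = some (Sum.inl X))
    (hU : U.label [] = some (Sum.inl X)) (h : ∀ c < ar X, T.child c = U.child c) : T = U := by
  ext1
  funext γ
  cases γ with
  | nil => rw [hT, hU]
  | cons c γ =>
    by_cases hc : c < ar X
    · rw [← child_label ((label_singleton_ne_none hT c).2 hc), h c hc,
        child_label ((label_singleton_ne_none hU c).2 hc)]
    · rw [label_cons_eq_none hT hc, label_cons_eq_none hU hc]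

theorem eq_flat_subst {T : RegTerm ar} {X : N} (h : T.label [] = some (Sum.inl X)) :
    T = (flat X).subst T.child :=
  ext_child h (flat_subst_label_nil X _) fun _ hc => (flat_subst_child X _ hc).symm

theorem flat_varsIn (X : N) : (flat X : RegTerm ar).VarsIn {j | j < ar X} := by
  intro γ j h
  cases γ with
  | nil => simp [flat_label_nil] at h
  | cons c γ =>
    by_cases hc : c < ar X
    · rw [← child_label ((label_singleton_ne_none (flat_label_nil X) c).2 hc), flat_child X hc,
        label_var] at h
      obtain ⟨_, h⟩ := h
      obtain rfl : j = c := by simpa using h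
      exact hc
    · simp [label_cons_eq_none (flat_label_nil X) hc] at h

theorem subst_eq_some {E : RegTerm ar} {σ : ℕ → RegTerm ar} {γ : List ℕ} {s : N ⊕ ℕ}
    (h : (E.subst σ).label γ = some s) :
    (E.label γ = some s ∧ ∃ X, s = Sum.inl X) ∨
      ∃ γ₁ γ₂ j, γ = γ₁ ++ γ₂ ∧ E.label γ₁ = some (Sum.inr j) ∧ (σ j).label γ₂ = some s :=
  substLabel_eq_some _ γ s _ h

theorem VarsIn.subst {D D' : Set ℕ} {E : RegTerm ar} (hE : E.VarsIn D) {σ : ℕ → RegTerm ar}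
    (hσ : ∀ j ∈ D, (σ j).VarsIn D') : (E.subst σ).VarsIn D' := by
  intro γ j h
  rcases subst_eq_some h with ⟨_, X, hX⟩ | ⟨γ₁, γ₂, k, rfl, h1, h2⟩
  · simp at hX
  · exact hσ k (hE _ _ h1) _ _ h2

theorem var_varsIn {D : Set ℕ} {j : ℕ} (h : j ∈ D) : (var j : RegTerm ar).VarsIn D := by
  intro γ k hk
  rw [label_var] at hk
  obtain rfl : k = j := by simpa using hk.2
  exact h

theorem VarsIn.child {D : Set ℕ} {E : RegTerm ar} (hE : E.VarsIn D) (c : ℕ) :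
    (E.child c).VarsIn D := by
  obtain ⟨δ, _, h⟩ := E.child_label_eq c
  exact fun γ j hj => hE (δ ++ γ) j (h γ ▸ hj)

theorem IsGround.child {E : RegTerm ar} (hE : E.IsGround) (c : ℕ) : (E.child c).IsGround :=
  VarsIn.isGround (VarsIn.child (hE.varsIn _) c)

theorem subst_var (E : RegTerm ar) : E.subst var = E := by
  ext1
  funext γ
  induction γ generalizing E with
  | nil =>
    rcases E.exists_label_nil with ⟨j, rfl⟩ | ⟨X, hX⟩
    · rw [var_subst]
    · rw [subst_label_nil hX, hX]
  | cons c γ ih =>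
    rcases E.exists_label_nil with ⟨j, rfl⟩ | ⟨X, hX⟩
    · rw [var_subst]
    · by_cases hc : c < ar X
      · rw [subst_label_cons hX _ hc, ih, child_label ((label_singleton_ne_none hX c).2 hc)]
      · rw [label_cons_eq_none hX hc, label_cons_eq_none (subst_label_nil hX _) hc]

theorem IsGround.subst_eq {E : RegTerm ar} (h : E.IsGround) (σ : ℕ → RegTerm ar) :
    E.subst σ = E := by
  rw [subst_congr (D := ∅) (h.varsIn _) (τ := var) (by simp), subst_var]

/-! ### Limits -/

/-- Redirecting the edges into `i` back to the root amounts to unfolding once. The hypothesis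
excludes `H = var i`, whose root no edge enters and which is therefore its own limit. -/
theorem lim_eq {i : ℕ} {H : RegTerm ar} (hH : H ≠ var i) :
    H.lim i = H.subst (Function.update var i (H.lim i)) := by
  have key : ∀ (γ : List ℕ) (E : RegTerm ar), E ≠ var i →
      limLabel i H.label γ E.label =
        (E.subst (Function.update var i (H.lim i))).label γ := by
    intro γ
    induction γ with
    | nil =>
      intro E hE
      rcases E.exists_label_nil with ⟨j, rfl⟩ | ⟨X, hX⟩
      · have hj : j ≠ i := by rintro rfl; exact hE rfl
        simp [limLabel, Function.update_of_ne hj]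
      · rw [subst_label_nil hX, limLabel, hX]
    | cons c γ ih =>
      intro E hE
      rcases E.exists_label_nil with ⟨j, rfl⟩ | ⟨X, hX⟩
      · have hj : j ≠ i := by rintro rfl; exact hE rfl
        rw [var_subst, Function.update_of_ne hj, limLabel, if_neg (by simp [var])]
        exact limLabel_of_none _ _ _
      · by_cases hc : c < ar X
        · have hc' := (label_singleton_ne_none hX c).2 hc
          rw [subst_label_cons hX _ hc, limLabel]
          by_cases h : E.label [c] = some (Sum.inr i)
          · have : E.child c = var i := eq_var_of_label (by rw [child_label hc', h])
            rw [if_pos h, this, var_subst, Function.update_self]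
            rfl
          · rw [if_neg h, ← ih]
            · congr 1
              funext δ
              rw [child_label hc']
            · intro he
              apply h
              rw [← child_label hc', he]
              rfl
        · rw [label_cons_eq_none (subst_label_nil hX _) hc, limLabel,
            if_neg (by rw [label_cons_eq_none hX hc]; simp)]
          rw [show (fun δ => E.label (c :: δ)) = fun _ => none from
            funext fun δ => label_cons_eq_none hX hc δ]
          exact limLabel_of_none _ _ _
  ext1
  funext γ
  exact key γ H hH

theorem lim_varsIn {i : ℕ} {D : Set ℕ} {H : RegTerm ar} (hH : H ≠ var i) (hD : H.VarsIn D) :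
    (H.lim i).VarsIn (D \ {i}) := by
  have h0 : H.label [] ≠ some (Sum.inr i) := fun h => hH (eq_var_of_label h)
  exact fun γ j h => limLabel_eq_var h0 hD γ H.label h0 hD h

theorem subst_label_agree {σ τ : ℕ → RegTerm ar} {k : ℕ}
    (h : ∀ j γ, γ.length < k → (σ j).label γ = (τ j).label γ) :
    ∀ (γ : List ℕ) (E : RegTerm ar), γ.length < k →
      (E.subst σ).label γ = (E.subst τ).label γ := by
  intro γ
  induction γ with
  | nil =>
    intro E hγ
    rcases E.exists_label_nil with ⟨j, rfl⟩ | ⟨X, hX⟩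
    · simpa using h j [] hγ
    · rw [subst_label_nil hX, subst_label_nil hX]
  | cons c γ ih =>
    intro E hγ
    rcases E.exists_label_nil with ⟨j, rfl⟩ | ⟨X, hX⟩
    · simpa using h j _ hγ
    · by_cases hc : c < ar X
      · rw [subst_label_cons hX _ hc, subst_label_cons hX _ hc]
        exact ih _ (by simp at hγ; omega)
      · rw [label_cons_eq_none (subst_label_nil hX _) hc,
          label_cons_eq_none (subst_label_nil hX _) hc]

/-- `F^lim` is the only solution of `Y = F(Y)` unless `F` is the variable itself. -/
theorem eq_lim {F Y : RegTerm ar} {i : ℕ} (hF : F ≠ var i)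
    (hY : Y = F.subst (Function.update var i Y)) : Y = F.lim i := by
  have hZ := lim_eq hF
  rcases F.exists_label_nil with ⟨j, rfl⟩ | ⟨X, hX⟩
  · have hj : j ≠ i := by rintro rfl; exact hF rfl
    rw [var_subst, Function.update_of_ne hj] at hY hZ
    rw [hY, hZ]
  -- Both terms solve the same equation with a nonterminal at the root of `F`, so agreement at
  -- depths below k passes to depths below k + 1.
  · have key : ∀ k, ∀ γ : List ℕ, γ.length < k → Y.label γ = (F.lim i).label γ := by
      intro k
      induction k with
      | zero => simp
      | succ k ih =>
        intro γ hγ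
        rw [hY, hZ]
        cases γ with
        | nil => rw [subst_label_nil hX, subst_label_nil hX]
        | cons c γ =>
          by_cases hc : c < ar X
          · rw [subst_label_cons hX _ hc, subst_label_cons hX _ hc]
            refine subst_label_agree (k := k) (fun j δ hδ => ?_) _ _ (by simpa using hγ)
            by_cases hj : j = i
            · subst hj
              simpa using ih δ hδ
            · simp [Function.update_of_ne hj]
          · rw [label_cons_eq_none (subst_label_nil hX _) hc,
              label_cons_eq_none (subst_label_nil hX _) hc]
    ext1
    funext γ
    exact key _ γ (Nat.lt_succ_self _)

theorem IsGround.ne_var {F : RegTerm ar} (h : F.IsGround) (i : ℕ) : F ≠ var i := by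
  rintro rfl
  exact h [] i rfl

theorem IsGround.lim_eq_self {F : RegTerm ar} (h : F.IsGround) (i : ℕ) : F.lim i = F :=
  (eq_lim (h.ne_var i) (h.subst_eq _).symm).symm

/-! ### Heights and depths -/

/-- Every node of `E` has depth at most `h`. -/
def HeightLE (h : ℕ) (E : RegTerm ar) : Prop :=
  ∀ γ, E.label γ ≠ none → γ.length ≤ h

/-- Every occurrence of a variable in `E` has depth at least `d`. -/
def DepthGE (d : ℕ) (E : RegTerm ar) : Prop :=
  ∀ γ j, E.label γ = some (Sum.inr j) → d ≤ γ.length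

theorem HeightLE.mono {h k : ℕ} {E : RegTerm ar} (hE : E.HeightLE h) (hk : h ≤ k) :
    E.HeightLE k := fun γ hγ => (hE γ hγ).trans hk

theorem DepthGE.mono {h k : ℕ} {E : RegTerm ar} (hE : E.DepthGE h) (hk : k ≤ h) :
    E.DepthGE k := fun γ j hγ => hk.trans (hE γ j hγ)

theorem IsFinite.exists_heightLE {E : RegTerm ar} (h : E.IsFinite) : ∃ k, E.HeightLE k := by
  obtain ⟨k, hk⟩ := (h.image List.length).bddAbove
  exact ⟨k, fun γ hγ => hk ⟨γ, hγ, rfl⟩⟩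

theorem HeightLE.subst {h k : ℕ} {D : Set ℕ} {E : RegTerm ar} {σ : ℕ → RegTerm ar}
    (hE : E.HeightLE h) (hD : E.VarsIn D) (hσ : ∀ j ∈ D, (σ j).HeightLE k) :
    (E.subst σ).HeightLE (h + k) := by
  intro γ hγ
  obtain ⟨s, hs⟩ := Option.ne_none_iff_exists'.1 hγ
  rcases subst_eq_some hs with ⟨h1, _⟩ | ⟨γ₁, γ₂, j, rfl, h1, h2⟩
  · exact (hE γ (by simp [h1])).trans (Nat.le_add_right _ _)
  · rw [List.length_append]
    exact Nat.add_le_add (hE γ₁ (by simp [h1])) (hσ j (hD _ _ h1) γ₂ (by simp [h2]))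

theorem HeightLE.child {h : ℕ} {E : RegTerm ar} (hE : E.HeightLE (h + 1)) {X : N}
    (hX : E.label [] = some (Sum.inl X)) {c : ℕ} (hc : c < ar X) : (E.child c).HeightLE h := by
  intro γ hγ
  rw [child_label ((label_singleton_ne_none hX c).2 hc)] at hγ
  simpa using hE _ hγ

theorem not_heightLE_zero {E : RegTerm ar} {X : N}
    (hX : E.label [] = some (Sum.inl X)) {c : ℕ} (hc : c < ar X) : ¬ E.HeightLE 0 := by
  intro h
  simpa using h _ ((label_singleton_ne_none hX c).2 hc)

theorem flat_heightLE (X : N) : (flat X : RegTerm ar).HeightLE 1 := by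
  intro γ hγ
  cases γ with
  | nil => simp
  | cons c γ =>
    by_cases hc : c < ar X
    · rw [← child_label ((label_singleton_ne_none (flat_label_nil X) c).2 hc),
        flat_child X hc] at hγ
      cases γ with
      | nil => simp
      | cons d γ => simp [var] at hγ
    · exact absurd (label_cons_eq_none (flat_label_nil X) hc γ) hγ

theorem DepthGE.subst {d : ℕ} {D : Set ℕ} {E : RegTerm ar} {σ : ℕ → RegTerm ar}
    (hD : E.VarsIn D) (hσ : ∀ j ∈ D, (σ j).DepthGE d) : (E.subst σ).DepthGE d := by
  intro γ k hk
  rcases subst_eq_some hk with ⟨_, X, hX⟩ | ⟨γ₁, γ₂, j, rfl, h1, h2⟩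
  · simp at hX
  · rw [List.length_append]
    exact (hσ j (hD _ _ h1) γ₂ k h2).trans (Nat.le_add_left _ _)

theorem DepthGE.child {d : ℕ} {E : RegTerm ar} (hE : E.DepthGE (d + 1)) (c : ℕ) :
    (E.child c).DepthGE d := by
  intro γ j hj
  obtain ⟨δ, hδ, h⟩ := E.child_label_eq c
  have := hE (δ ++ γ) j (h γ ▸ hj)
  rw [List.length_append] at this
  omega

theorem DepthGE.exists_label_nil {d : ℕ} {E : RegTerm ar} (hE : E.DepthGE (d + 1)) :
    ∃ X, E.label [] = some (Sum.inl X) := by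
  rcases E.exists_label_nil with ⟨j, rfl⟩ | h
  · simpa using hE [] j rfl
  · exact h

/-! ### Subterms -/

/-- The set of subterms of `T`. -/
def subterms (T : RegTerm ar) : Set (RegTerm ar) :=
  {C | ∃ γ, C.label = Labelling.at T.label γ}

theorem subterms_finite (T : RegTerm ar) : T.subterms.Finite := by
  refine Set.Finite.of_finite_image (f := RegTerm.label) (T.range_finite.subset ?_)
    (fun C _ C' _ h => RegTerm.ext h)
  rintro _ ⟨C, ⟨γ, h⟩, rfl⟩
  exact ⟨γ, h.symm⟩

theorem self_mem_subterms (T : RegTerm ar) : T ∈ T.subterms := ⟨[], rfl⟩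

theorem child_mem_subterms {T C : RegTerm ar} (h : C ∈ T.subterms) (c : ℕ) :
    C.child c ∈ T.subterms := by
  obtain ⟨γ, h⟩ := h
  obtain ⟨δ, _, hδ⟩ := C.child_label_eq c
  refine ⟨γ ++ δ, funext fun ε => ?_⟩
  rw [hδ, h]
  simp [Labelling.at]

/-! ### Cutting a term at a given depth -/

/-- Only finitely many tree shapes exist down to depth `d`, since nonterminals and arities are
finite; whatever lies below is left to the substitution. -/
theorem exists_cut [Finite N] (d : ℕ) :
    ∃ 𝓟 : Set (RegTerm ar), 𝓟.Finite ∧ (∀ P ∈ 𝓟, P.DepthGE d) ∧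
      ∀ T : RegTerm ar, T.IsGround → ∃ P ∈ 𝓟, ∃ σ : ℕ → RegTerm ar,
        (∀ j, (σ j).IsGround) ∧ T = P.subst σ := by
  induction d with
  | zero =>
    exact ⟨{var 0}, Set.finite_singleton _, fun P _ γ j _ => Nat.zero_le _,
      fun T hT => ⟨var 0, rfl, fun _ => T, fun _ => hT, by simp⟩⟩
  | succ d ih =>
    obtain ⟨𝓟, hfin, hdepth, hcut⟩ := ih
    have := hfin.to_subtype
    -- `Nat.pair i j` keeps the variables of different successors apart, so that the substitutions
    -- found for the successors combine into one.
    let f : (Σ X : N, Fin (ar X) → 𝓟) → RegTerm ar := fun p =>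
      node p.1 fun i => (p.2 i : RegTerm ar).subst fun j => var (Nat.pair i j)
    refine ⟨Set.range f, Set.finite_range f, ?_, ?_⟩
    · rintro _ ⟨⟨X, P⟩, rfl⟩ γ j hj
      cases γ with
      | nil => simp [f, node] at hj
      | cons c γ =>
        by_cases hc : c < ar X
        · simp only [f, node, hc, dite_true] at hj
          rcases subst_eq_some hj with ⟨_, X, hX⟩ | ⟨γ₁, γ₂, k, rfl, h1, h2⟩
          · simp at hX
          · have := hdepth _ (P ⟨c, hc⟩).2 _ _ h1
            simp only [List.length_cons, List.length_append]
            omega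
        · simp [f, node, hc] at hj
    · intro T hT
      obtain ⟨X, hX⟩ := hT.exists_label_nil
      choose P hP σ hσ hT' using fun c => hcut (T.child c) (hT.child c)
      refine ⟨f ⟨X, fun i => ⟨P i, hP i⟩⟩, ⟨_, rfl⟩,
        fun j => σ (Nat.unpair j).1 (Nat.unpair j).2, fun j => hσ _ _, ?_⟩
      have h0 : (f ⟨X, fun i => ⟨P i, hP i⟩⟩).label [] = some (Sum.inl X) := rfl
      refine ext_child hX (subst_label_nil h0 _) fun c hc => ?_
      rw [child_subst h0 _ hc]
      have : (f ⟨X, fun i => ⟨P i, hP i⟩⟩).child c =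
          (P c).subst fun j => var (Nat.pair c j) := by
        ext1
        funext γ
        rw [child_label ((label_singleton_ne_none h0 c).2 hc)]
        simp [f, node, hc]
      rw [this, subst_subst]
      simpa using hT' c

end RegTerm
/-! ### Transitions -/

theorem LTS.reach_append {S : Type u} {A : Type v} (L : LTS S A) {s t : S} {w x : List A} :
    L.Reach s (w ++ x) t ↔ ∃ m, L.Reach s w m ∧ L.Reach m x t := by
  induction w generalizing s with
  | nil => exact ⟨fun h => ⟨s, rfl, h⟩, by rintro ⟨_, rfl, h⟩; exact h⟩
  | cons a w ih =>
    constructor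
    · rintro ⟨s₁, h1, h2⟩
      obtain ⟨m, h3, h4⟩ := ih.1 h2
      exact ⟨m, ⟨s₁, h1, h3⟩, h4⟩
    · rintro ⟨m, ⟨s₁, h1, h2⟩, h3⟩
      exact ⟨s₁, h1, ih.2 ⟨m, h2, h3⟩⟩

theorem LTS.reach_singleton {S : Type u} {A : Type v} (L : LTS S A) {s t : S} {a : A} :
    L.Reach s [a] t ↔ L.step s a t :=
  ⟨by rintro ⟨_, h, rfl⟩; exact h, fun h => ⟨t, h, rfl⟩⟩

theorem LTS.nil_mem_traces {S : Type u} {A : Type v} (L : LTS S A) (s : S) : [] ∈ L.traces s :=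
  ⟨s, rfl⟩

theorem LTS.cons_mem_traces {S : Type u} {A : Type v} (L : LTS S A) {s : S} {a : A}
    {w : List A} : a :: w ∈ L.traces s ↔ ∃ t, L.step s a t ∧ w ∈ L.traces t :=
  ⟨by rintro ⟨t, s₁, h1, h2⟩; exact ⟨s₁, h1, t, h2⟩,
    by rintro ⟨s₁, h1, t, h2⟩; exact ⟨t, s₁, h1, h2⟩⟩

theorem LTS.TraceEquiv.upTo {S : Type u} {A : Type v} {L : LTS S A} {s t : S}
    (h : L.TraceEquiv s t) (k : ℕ) : L.TraceEquivUpTo k s t := by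
  unfold LTS.TraceEquivUpTo LTS.tracesUpTo
  rw [show L.traces s = L.traces t from h]

namespace Grammar

open RegTerm

variable {N : Type u} {A : Type v} {G : Grammar N A}

theorem step_iff {T T' : G.Term} {a : A} :
    G.lts.step T a T' ↔
      ∃ X E, T.label [] = some (Sum.inl X) ∧ (X, a, E) ∈ G.rules ∧ T' = E.subst T.child := by
  constructor
  · rintro ⟨X, E, σ, hE, rfl, rfl⟩
    refine ⟨X, E, flat_subst_label_nil X σ, hE, ?_⟩
    exact subst_congr (D := {j | j < G.arity X}) (G.rhs_vars X a E hE)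
      fun j hj => (flat_subst_child X σ hj).symm
  · rintro ⟨X, E, hX, hE, rfl⟩
    exact ⟨X, E, T.child, hE, eq_flat_subst hX, rfl⟩

theorem not_step_var (j : ℕ) (a : A) (T : G.Term) : ¬ G.lts.step (var j) a T := by
  rw [step_iff]
  rintro ⟨X, E, hX, _⟩
  simp [var] at hX

theorem reach_var {j : ℕ} {w : List A} {T : G.Term} (h : G.lts.Reach (var j) w T) :
    w = [] ∧ T = var j := by
  cases w with
  | nil => exact ⟨rfl, h.symm⟩
  | cons a w =>
    obtain ⟨_, h, _⟩ := h
    exact absurd h (not_step_var _ _ _)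

theorem step_det (hdet : G.IsDeterministic) {T T₁ T₂ : G.Term} {a : A}
    (h₁ : G.lts.step T a T₁) (h₂ : G.lts.step T a T₂) : T₁ = T₂ := by
  rw [step_iff] at h₁ h₂
  obtain ⟨X, E, hX, hE, rfl⟩ := h₁
  obtain ⟨X', E', hX', hE', rfl⟩ := h₂
  obtain rfl : X = X' := by simpa using hX.symm.trans hX'
  rw [hdet _ _ _ _ hE hE']

theorem reach_det (hdet : G.IsDeterministic) {T T₁ T₂ : G.Term} {w : List A}
    (h₁ : G.lts.Reach T w T₁) (h₂ : G.lts.Reach T w T₂) : T₁ = T₂ := by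
  induction w generalizing T with
  | nil => exact h₁.symm.trans h₂
  | cons a w ih =>
    obtain ⟨S₁, h1, h2⟩ := h₁
    obtain ⟨S₂, h3, h4⟩ := h₂
    obtain rfl := step_det hdet h1 h3
    exact ih h2 h4

theorem reach_of_append (hdet : G.IsDeterministic) {T T₁ T₂ : G.Term} {w x : List A}
    (h₁ : G.lts.Reach T w T₁) (h₂ : G.lts.Reach T (w ++ x) T₂) : G.lts.Reach T₁ x T₂ := by
  obtain ⟨m, h3, h4⟩ := (LTS.reach_append _).1 h₂
  rwa [reach_det hdet h₁ h3]

theorem step_subst {E E' : G.Term} {a : A} (h : G.lts.step E a E') (σ : ℕ → G.Term) :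
    G.lts.step (E.subst σ) a (E'.subst σ) := by
  obtain ⟨X, R, ρ, hR, rfl, rfl⟩ := h
  exact ⟨X, R, fun j => (ρ j).subst σ, hR, subst_subst _ _ _, subst_subst _ _ _⟩

theorem reach_subst {E E' : G.Term} {w : List A} (h : G.lts.Reach E w E') (σ : ℕ → G.Term) :
    G.lts.Reach (E.subst σ) w (E'.subst σ) := by
  induction w generalizing E with
  | nil => exact congrArg (fun F => F.subst σ) h
  | cons a w ih =>
    obtain ⟨E₁, h1, h2⟩ := h
    exact ⟨E₁.subst σ, step_subst h1 σ, ih h2⟩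

theorem step_subst_inv {E T' : G.Term} {X : N} (hX : E.label [] = some (Sum.inl X))
    {σ : ℕ → G.Term} {a : A} (h : G.lts.step (E.subst σ) a T') :
    ∃ E', G.lts.step E a E' ∧ T' = E'.subst σ := by
  rw [step_iff] at h
  obtain ⟨Y, R, hY, hR, rfl⟩ := h
  obtain rfl : X = Y := by simpa using (subst_label_nil hX σ).symm.trans hY
  refine ⟨R.subst E.child, step_iff.2 ⟨X, R, hX, hR, rfl⟩, ?_⟩
  rw [subst_subst]
  exact subst_congr (D := {j | j < G.arity X}) (G.rhs_vars X a R hR)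
    fun j hj => child_subst hX σ hj

/-- A run of an instance either stays in the pattern or first reaches a variable and continues
inside the term substituted for it. -/
theorem reach_subst_inv {E T' : G.Term} {σ : ℕ → G.Term} {w : List A}
    (h : G.lts.Reach (E.subst σ) w T') :
    (∃ E', G.lts.Reach E w E' ∧ T' = E'.subst σ) ∨
      ∃ w₁ w₂ j, w = w₁ ++ w₂ ∧ w₂ ≠ [] ∧ G.lts.Reach E w₁ (var j) ∧
        G.lts.Reach (σ j) w₂ T' := by
  induction w generalizing E with
  | nil => exact Or.inl ⟨E, rfl, h.symm⟩
  | cons a w ih =>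
    rcases E.exists_label_nil with ⟨j, rfl⟩ | ⟨X, hX⟩
    · exact Or.inr ⟨[], a :: w, j, rfl, by simp, rfl, by simpa using h⟩
    · obtain ⟨T₁, h1, h2⟩ := h
      obtain ⟨E₁, h3, rfl⟩ := step_subst_inv hX h1
      rcases ih h2 with ⟨E', h4, h5⟩ | ⟨w₁, w₂, j, rfl, h4, h5, h6⟩
      · exact Or.inl ⟨E', ⟨E₁, h3, h4⟩, h5⟩
      · exact Or.inr ⟨a :: w₁, w₂, j, rfl, h4, ⟨E₁, h3, h5⟩, h6⟩

theorem step_varsIn {T T' : G.Term} {a : A} {D : Set ℕ} (h : G.lts.step T a T')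
    (hT : T.VarsIn D) : T'.VarsIn D := by
  obtain ⟨X, E, hX, hE, rfl⟩ := step_iff.1 h
  exact VarsIn.subst (G.rhs_vars X a E hE) fun j _ => hT.child j

theorem reach_varsIn {T T' : G.Term} {w : List A} {D : Set ℕ} (h : G.lts.Reach T w T')
    (hT : T.VarsIn D) : T'.VarsIn D := by
  induction w generalizing T with
  | nil => exact (show T = T' from h) ▸ hT
  | cons a w ih =>
    obtain ⟨T₁, h1, h2⟩ := h
    exact ih h2 (step_varsIn h1 hT)

theorem reach_isGround {T T' : G.Term} {w : List A} (h : G.lts.Reach T w T')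
    (hT : T.IsGround) : T'.IsGround :=
  VarsIn.isGround (reach_varsIn h (hT.varsIn _))

theorem lt_arity_of_reach {X : N} {w : List A} {i : ℕ}
    (h : G.lts.Reach (flat X) w (var i)) : i < G.arity X :=
  reach_varsIn h (flat_varsIn X) [] i rfl

theorem ne_nil_of_reach_flat {X : N} {w : List A} {i : ℕ}
    (h : G.lts.Reach (flat X) w (var i)) : w ≠ [] := by
  rintro rfl
  have := congrArg (fun E => E.label []) (show (flat X : G.Term) = var i from h)
  simp [flat_label_nil, var] at this

theorem exists_rhs_height (G : Grammar N A) :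
    ∃ d, ∀ X a E, (X, a, E) ∈ G.rules → E.HeightLE d := by
  have : ∀ p : N × A × G.Term, ∃ d, p ∈ G.rules → p.2.2.HeightLE d := by
    intro p
    by_cases hp : p ∈ G.rules
    · obtain ⟨d, hd⟩ := (G.rhs_finite _ _ _ hp).exists_heightLE
      exact ⟨d, fun _ => hd⟩
    · exact ⟨0, fun h => absurd h hp⟩
  choose d hd using this
  obtain ⟨m, hm⟩ := (G.rules_finite.image d).bddAbove
  exact ⟨m, fun X a E hE => (hd _ hE).mono (hm ⟨_, hE, rfl⟩)⟩

theorem reach_heightLE {d : ℕ} (hd : ∀ X a E, (X, a, E) ∈ G.rules → E.HeightLE d)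
    {T T' : G.Term} {w : List A} {h : ℕ} (hw : G.lts.Reach T w T') (hT : T.HeightLE h) :
    T'.HeightLE (h + w.length * d) := by
  induction w generalizing T h with
  | nil => simpa using (show T = T' from hw) ▸ hT
  | cons a w ih =>
    obtain ⟨T₁, h1, h2⟩ := hw
    obtain ⟨X, E, hX, hE, rfl⟩ := step_iff.1 h1
    refine (ih h2 (HeightLE.subst (hd X a E hE) (G.rhs_vars X a E hE) (k := h)
      fun j hj => ?_)).mono (le_of_eq (by simp only [List.length_cons]; ring))
    cases h with
    | zero => exact absurd hT (not_heightLE_zero hX hj)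
    | succ h => exact (hT.child hX hj).mono (Nat.le_succ h)

theorem step_depthGE {T T' : G.Term} {a : A} {d : ℕ} (h : G.lts.step T a T')
    (hT : T.DepthGE (d + 1)) : T'.DepthGE d := by
  obtain ⟨X, E, hX, hE, rfl⟩ := step_iff.1 h
  exact DepthGE.subst (G.rhs_vars X a E hE) fun j _ => hT.child j

/-- A word shorter than the depth of the variables of `E` does not reach them. -/
theorem reach_subst_inv_of_depthGE {E T' : G.Term} {σ : ℕ → G.Term} {w : List A}
    (hE : E.DepthGE w.length) (h : G.lts.Reach (E.subst σ) w T') :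
    ∃ E', G.lts.Reach E w E' ∧ T' = E'.subst σ := by
  induction w generalizing E with
  | nil => exact ⟨E, rfl, h.symm⟩
  | cons a w ih =>
    obtain ⟨X, hX⟩ := DepthGE.exists_label_nil (d := w.length) hE
    obtain ⟨T₁, h1, h2⟩ := h
    obtain ⟨E₁, h3, rfl⟩ := step_subst_inv hX h1
    obtain ⟨E', h4, h5⟩ := ih (step_depthGE h3 hE) h2
    exact ⟨E', ⟨E₁, h3, h4⟩, h5⟩

/-- The terms reachable from `T` by words of length at most `k`. -/
def reachSet (G : Grammar N A) (k : ℕ) (T : G.Term) : Set G.Term :=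
  {T' | ∃ w : List A, w.length ≤ k ∧ G.lts.Reach T w T'}

theorem reachSet_finite (G : Grammar N A) (k : ℕ) (T : G.Term) : (G.reachSet k T).Finite := by
  induction k generalizing T with
  | zero =>
    refine (Set.finite_singleton T).subset ?_
    rintro T' ⟨w, hw, h⟩
    obtain rfl : w = [] := List.length_eq_zero_iff.1 (Nat.le_zero.1 hw)
    exact h.symm
  | succ k ih =>
    have hstep : {T₁ | ∃ a, G.lts.step T a T₁}.Finite := by
      refine (G.rules_finite.image fun p => p.2.2.subst T.child).subset ?_
      rintro T₁ ⟨a, h⟩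
      obtain ⟨X, E, _, hE, rfl⟩ := step_iff.1 h
      exact ⟨_, hE, rfl⟩
    refine ((hstep.biUnion fun T₁ _ => ih T₁).insert T).subset ?_
    rintro T' ⟨w, hw, h⟩
    cases w with
    | nil => exact Or.inl h.symm
    | cons a w =>
      obtain ⟨T₁, h1, h2⟩ := h
      exact Or.inr (Set.mem_biUnion (x := T₁) ⟨a, h1⟩ ⟨w, by simpa using hw, h2⟩)

/-! ### Trace equivalence -/

theorem TraceEquiv.exists_step (hdet : G.IsDeterministic) {T T' U : G.Term} {a : A}
    (h : G.lts.TraceEquiv T U) (hT : G.lts.step T a T') :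
    ∃ U', G.lts.step U a U' ∧ G.lts.TraceEquiv T' U' := by
  have key : ∀ w, a :: w ∈ G.lts.traces T ↔ a :: w ∈ G.lts.traces U := fun w => by
    rw [show G.lts.traces T = G.lts.traces U from h]
  obtain ⟨U', hU, _⟩ := (LTS.cons_mem_traces _).1
    ((key []).1 ((LTS.cons_mem_traces _).2 ⟨T', hT, LTS.nil_mem_traces _ _⟩))
  refine ⟨U', hU, Set.ext fun w => ?_⟩
  have := key w
  rw [LTS.cons_mem_traces, LTS.cons_mem_traces] at this
  constructor
  · intro hw
    obtain ⟨U'', h1, h2⟩ := this.1 ⟨T', hT, hw⟩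
    rwa [step_det hdet hU h1]
  · intro hw
    obtain ⟨T'', h1, h2⟩ := this.2 ⟨U', hU, hw⟩
    rwa [step_det hdet hT h1]

theorem TraceEquiv.exists_reach (hdet : G.IsDeterministic) {T T' U : G.Term} {w : List A}
    (h : G.lts.TraceEquiv T U) (hT : G.lts.Reach T w T') :
    ∃ U', G.lts.Reach U w U' ∧ G.lts.TraceEquiv T' U' := by
  induction w generalizing T U with
  | nil => exact ⟨U, rfl, (show T = T' from hT) ▸ h⟩
  | cons a w ih =>
    obtain ⟨T₁, h1, h2⟩ := hT
    obtain ⟨U₁, h3, h4⟩ := TraceEquiv.exists_step hdet h h1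
    obtain ⟨U', h5, h6⟩ := ih h4 h2
    exact ⟨U', ⟨U₁, h3, h5⟩, h6⟩

theorem mem_traces_subst {σ τ : ℕ → G.Term} {k : ℕ}
    (h : ∀ j w, w.length ≤ k → w ∈ G.lts.traces (σ j) → w ∈ G.lts.traces (τ j))
    {w : List A} (E : G.Term) (hw : w.length ≤ k) (hE : w ∈ G.lts.traces (E.subst σ)) :
    w ∈ G.lts.traces (E.subst τ) := by
  induction w generalizing E with
  | nil => exact LTS.nil_mem_traces _ _
  | cons a w ih =>
    rcases E.exists_label_nil with ⟨j, rfl⟩ | ⟨X, hX⟩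
    · rw [var_subst] at hE ⊢
      exact h j _ hw hE
    · obtain ⟨T₁, h1, h2⟩ := (LTS.cons_mem_traces _).1 hE
      obtain ⟨E₁, h3, rfl⟩ := step_subst_inv hX h1
      exact (LTS.cons_mem_traces _).2
        ⟨_, step_subst h3 τ, ih E₁ (by simp at hw; omega) h2⟩

/-- A nonterminal at the root costs one step before any variable is reached. This gain of one letter
drives the induction in `TraceEquiv.lim`. -/
theorem mem_traces_subst_succ {σ τ : ℕ → G.Term} {k : ℕ}
    (h : ∀ j w, w.length ≤ k → w ∈ G.lts.traces (σ j) → w ∈ G.lts.traces (τ j))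
    {w : List A} {E : G.Term} {X : N} (hX : E.label [] = some (Sum.inl X))
    (hw : w.length ≤ k + 1) (hE : w ∈ G.lts.traces (E.subst σ)) :
    w ∈ G.lts.traces (E.subst τ) := by
  cases w with
  | nil => exact LTS.nil_mem_traces _ _
  | cons a w =>
    obtain ⟨T₁, h1, h2⟩ := (LTS.cons_mem_traces _).1 hE
    obtain ⟨E₁, h3, rfl⟩ := step_subst_inv hX h1
    exact (LTS.cons_mem_traces _).2
      ⟨_, step_subst h3 τ, mem_traces_subst h E₁ (by simpa using hw) h2⟩

theorem TraceEquiv.subst {σ τ : ℕ → G.Term} (h : ∀ j, G.lts.TraceEquiv (σ j) (τ j))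
    (E : G.Term) : G.lts.TraceEquiv (E.subst σ) (E.subst τ) :=
  Set.ext fun _ =>
    ⟨mem_traces_subst (fun j _ _ hx => (h j).subset hx) E le_rfl,
      mem_traces_subst (fun j _ _ hx => (h j).symm.subset hx) E le_rfl⟩

theorem TraceEquiv.inst {T U : G.Term} (h : G.lts.TraceEquiv T U) (E : G.Term) :
    G.lts.TraceEquiv (E.inst T) (E.inst U) := by
  refine TraceEquiv.subst (fun j => ?_) E
  by_cases hj : j = 0
  · subst hj; simpa using h
  · simp [Function.update_of_ne hj, LTS.TraceEquiv]

/-- Semantic counterpart of `eq_lim`: an equation guarded by a nonterminal determines its solution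
up to trace equivalence, by induction on the length of words. It is what makes limit replacement
preserve equivalence. -/
theorem TraceEquiv.lim {T F : G.Term} (hF : F ≠ var 0) (h : G.lts.TraceEquiv T (F.inst T)) :
    G.lts.TraceEquiv T (F.lim 0) := by
  have hlim := lim_eq hF
  rcases F.exists_label_nil with ⟨j, rfl⟩ | ⟨X, hX⟩
  · have hj : j ≠ 0 := by rintro rfl; exact hF rfl
    rw [RegTerm.inst, var_subst, Function.update_of_ne hj] at h
    rw [var_subst, Function.update_of_ne hj] at hlim
    rwa [hlim]
  · have key : ∀ k, ∀ w : List A, w.length ≤ k →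
        (w ∈ G.lts.traces T ↔ w ∈ G.lts.traces (F.lim 0)) := by
      intro k
      induction k with
      | zero =>
        intro w hw
        obtain rfl : w = [] := List.length_eq_zero_iff.1 (Nat.le_zero.1 hw)
        exact iff_of_true (LTS.nil_mem_traces _ _) (LTS.nil_mem_traces _ _)
      | succ k ih =>
        intro w hw
        rw [show G.lts.traces T = G.lts.traces (F.inst T) from h, hlim]
        constructor
        · refine mem_traces_subst_succ (fun j x hx hm => ?_) hX hw
          by_cases hj : j = 0
          · subst hj
            rw [Function.update_self] at hm ⊢
            exact (ih x hx).1 hm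
          · rwa [Function.update_of_ne hj] at hm ⊢
        · refine mem_traces_subst_succ (fun j x hx hm => ?_) hX hw
          by_cases hj : j = 0
          · subst hj
            rw [Function.update_self] at hm ⊢
            exact (ih x hx).2 hm
          · rwa [Function.update_of_ne hj] at hm ⊢
    exact Set.ext fun w => key _ w le_rfl

/-- If `Eσ ∼ Fσ` but some other instance of `(E, F)` is not a pair of equivalent terms, then some
word leads from one of the terms `E`, `F` to a variable but not from the other one. -/
theorem exists_exposing_word (hdet : G.IsDeterministic) {σ τ : ℕ → G.Term} {w : List A} :
    ∀ {E F : G.Term}, G.lts.TraceEquiv (E.subst σ) (F.subst σ) →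
      w ∈ G.lts.traces (E.subst τ) → w ∉ G.lts.traces (F.subst τ) →
      ∃ x i H, H ≠ var i ∧ ((G.lts.Reach E x (var i) ∧ G.lts.Reach F x H) ∨
        (G.lts.Reach F x (var i) ∧ G.lts.Reach E x H)) := by
  induction w with
  | nil => exact fun _ _ h => absurd (LTS.nil_mem_traces _ _) h
  | cons a w ih =>
    intro E F h hE hF
    -- The two patterns move in lockstep along the distinguishing word, because the σ-instances
    -- remain equivalent. The instances under τ can only come apart once one pattern is a variable
    -- and the other a different term.
    by_cases hEF : E = F
    · exact absurd (hEF ▸ hE) hF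
    rcases E.exists_label_nil with ⟨i, rfl⟩ | ⟨X, hX⟩
    · exact ⟨[], i, F, Ne.symm hEF, Or.inl ⟨rfl, rfl⟩⟩
    rcases F.exists_label_nil with ⟨i, rfl⟩ | ⟨Y, hY⟩
    · exact ⟨[], i, E, hEF, Or.inr ⟨rfl, rfl⟩⟩
    obtain ⟨T₁, h1, h2⟩ := (LTS.cons_mem_traces _).1 hE
    obtain ⟨E₁, h3, rfl⟩ := step_subst_inv hX h1
    obtain ⟨U₁, h4, h5⟩ := TraceEquiv.exists_step hdet h (step_subst h3 σ)
    obtain ⟨F₁, h6, rfl⟩ := step_subst_inv hY h4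
    obtain ⟨x, i, H, hH, h7⟩ := ih h5 h2 fun hw =>
      hF ((LTS.cons_mem_traces _).2 ⟨_, step_subst h6 τ, hw⟩)
    refine ⟨a :: x, i, H, hH, ?_⟩
    rcases h7 with ⟨h7, h8⟩ | ⟨h7, h8⟩
    · exact Or.inl ⟨⟨E₁, h3, h7⟩, ⟨F₁, h6, h8⟩⟩
    · exact Or.inr ⟨⟨F₁, h6, h7⟩, ⟨E₁, h3, h8⟩⟩

/-! ### Derived pairs -/

/-- The invariant compares each pair with the term that `T₀` itself reaches by the word; comparing
the two sides only with each other would also suffice for equivalence, but would lose which words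
remain enabled. -/
theorem Models.exists_reach_traceEquiv (hdet : G.IsDeterministic) {B : Set (G.Term × G.Term)}
    {T₀ U₀ : G.Term} (h0 : G.lts.TraceEquiv T₀ U₀) {u : List A} {T U : G.Term}
    (h : G.Models B T₀ U₀ u (.pair T U)) :
    ∃ T', G.lts.Reach T₀ u T' ∧ G.lts.TraceEquiv T' T ∧ G.lts.TraceEquiv T' U := by
  generalize hl : Label.pair T U = l at h
  induction h generalizing T U with
  | start =>
    cases hl
    exact ⟨_, rfl, rfl, h0⟩
  | basicTransition h1 h2 h3 h4 ih =>
    cases hl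
    obtain ⟨T', h5, h6, h7⟩ := ih rfl
    obtain ⟨T'', h8, h9⟩ := TraceEquiv.exists_step hdet h6.symm h3
    obtain ⟨U'', h10, h11⟩ := TraceEquiv.exists_step hdet h7.symm h4
    obtain rfl := step_det hdet h8 h10
    exact ⟨T'', (LTS.reach_append _).2 ⟨T', h5, (LTS.reach_singleton _).2 h8⟩, h9.symm,
      h11.symm⟩
  | limitReplacement hE hF h1 h2 h3 h4 ih1 ih2 =>
    cases hl
    obtain ⟨T', h5, h6, h7⟩ := ih1 rfl
    obtain ⟨T'', h8, h9, h10⟩ := ih2 rfl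
    exact ⟨T', h5, h6.trans (TraceEquiv.inst (TraceEquiv.lim h4 (h9.symm.trans h10)) _), h7⟩
  | symmetry h1 ih =>
    cases hl
    obtain ⟨T', h5, h6, h7⟩ := ih rfl
    exact ⟨T', h5, h7, h6⟩
  | basis => cases hl
  | progression => cases hl
  | rejection => cases hl

theorem Models.traceEquiv (hdet : G.IsDeterministic) {B : Set (G.Term × G.Term)}
    {T₀ U₀ : G.Term} (h0 : G.lts.TraceEquiv T₀ U₀) {u : List A} {T U : G.Term}
    (h : G.Models B T₀ U₀ u (.pair T U)) : G.lts.TraceEquiv T U := by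
  obtain ⟨_, _, h1, h2⟩ := h.exists_reach_traceEquiv hdet h0
  exact h1.symm.trans h2

theorem Models.isGround {B : Set (G.Term × G.Term)} {T₀ U₀ : G.Term} (hT : T₀.IsGround)
    (hU : U₀.IsGround) {u : List A} {T U : G.Term} (h : G.Models B T₀ U₀ u (.pair T U)) :
    T.IsGround ∧ U.IsGround := by
  generalize hl : Label.pair T U = l at h
  induction h generalizing T U with
  | start =>
    cases hl
    exact ⟨hT, hU⟩
  | basicTransition h1 h2 h3 h4 ih =>
    cases hl
    exact ⟨reach_isGround ((LTS.reach_singleton _).2 h3) (ih rfl).1,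
      reach_isGround ((LTS.reach_singleton _).2 h4) (ih rfl).2⟩
  | limitReplacement hE hF h1 h2 h3 h4 ih1 ih2 =>
    cases hl
    refine ⟨VarsIn.isGround (VarsIn.subst hE fun j hj => ?_), (ih1 rfl).2⟩
    obtain rfl : j = 0 := Nat.lt_one_iff.1 hj
    rw [Function.update_self]
    refine (lim_varsIn h4 hF).mono ?_
    rintro j ⟨hj, hj'⟩
    exact hj' (Nat.lt_one_iff.1 hj)
  | symmetry h1 ih =>
    cases hl
    exact (ih rfl).symm
  | basis => cases hl
  | progression => cases hl
  | rejection => cases hl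

theorem Models.reach (hdet : G.IsDeterministic) {B : Set (G.Term × G.Term)}
    {T₀ U₀ : G.Term} (h0 : G.lts.TraceEquiv T₀ U₀) {u w : List A} {T U T' U' : G.Term}
    (h : G.Models B T₀ U₀ u (.pair T U)) (hT : G.lts.Reach T w T') (hU : G.lts.Reach U w U') :
    G.Models B T₀ U₀ (u ++ w) (.pair T' U') := by
  induction w generalizing u T U with
  | nil =>
    obtain rfl : T = T' := hT
    obtain rfl : U = U' := hU
    simpa using h
  | cons a w ih =>
    obtain ⟨T₁, h1, h2⟩ := hT
    obtain ⟨U₁, h3, h4⟩ := hU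
    have := ih (.basicTransition h ((h.traceEquiv hdet h0).upTo 1) h1 h3) h2 h4
    simpa using this

theorem inst_subst_update {σ : ℕ → G.Term} (hσ : ∀ j, (σ j).IsGround) (E Y : G.Term) (i : ℕ) :
    (E.subst (Function.update σ i (var 0))).inst Y = E.subst (Function.update σ i Y) := by
  rw [RegTerm.inst, subst_subst]
  congr 1
  funext j
  by_cases hj : j = i
  · subst hj; simp
  · simp [Function.update_of_ne hj, (hσ j).subst_eq]

theorem subst_update_varsBelow {σ : ℕ → G.Term} (hσ : ∀ j, (σ j).IsGround) (E : G.Term)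
    (i : ℕ) : (E.subst (Function.update σ i (var 0))).VarsBelow 1 := by
  refine VarsIn.subst (D := Set.univ) (D' := {j | j < 1}) (fun _ _ _ => trivial) fun j _ => ?_
  by_cases hj : j = i
  · subst hj
    rw [Function.update_self]
    exact var_varsIn Nat.one_pos
  · rw [Function.update_of_ne hj]
    exact (hσ j).varsIn _

/-- With the other variables instantiated by ground terms, `E` becomes a context in one variable,
the form demanded by limit replacement. -/
theorem Models.replace {B : Set (G.Term × G.Term)} {T₀ U₀ : G.Term} {σ : ℕ → G.Term}
    (hσ : ∀ j, (σ j).IsGround) {u w : List A} {E F U : G.Term} {i : ℕ}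
    (h : G.Models B T₀ U₀ u (.pair (E.subst σ) U)) (hw : w.length < u.length)
    (hF : F.VarsBelow 1) (hF' : F ≠ var 0)
    (h' : G.Models B T₀ U₀ w (.pair (σ i) (F.inst (σ i)))) :
    G.Models B T₀ U₀ u (.pair (E.subst (Function.update σ i (F.lim 0))) U) := by
  have hE : E.subst σ = (E.subst (Function.update σ i (var 0))).inst (σ i) := by
    rw [inst_subst_update hσ, Function.update_eq_self]
  rw [hE] at h
  have := Models.limitReplacement (subst_update_varsBelow hσ E i) hF h hw h' hF'
  rwa [inst_subst_update hσ] at this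

/-- Limit replacement with a ground `F` is plain replacement of equals, since a ground term is its
own limit. -/
theorem Models.replace_ground {B : Set (G.Term × G.Term)} {T₀ U₀ : G.Term} {σ : ℕ → G.Term}
    (hσ : ∀ j, (σ j).IsGround) {u w : List A} {E W U : G.Term} {i : ℕ}
    (h : G.Models B T₀ U₀ u (.pair (E.subst σ) U)) (hw : w.length < u.length)
    (hW : W.IsGround) (h' : G.Models B T₀ U₀ w (.pair (σ i) W)) :
    G.Models B T₀ U₀ u (.pair (E.subst (Function.update σ i W)) U) := by
  have := h.replace hσ (F := W) (i := i) hw (hW.varsIn {j | j < 1}) (hW.ne_var 0)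
    (by rwa [RegTerm.inst, hW.subst_eq])
  rwa [hW.lim_eq_self] at this

/-- Limit and ground instantiation commute: both sides solve the same guarded equation, so
uniqueness of the solution applies. -/
theorem subst_lim {σ : ℕ → G.Term} (hσ : ∀ j, (σ j).IsGround) {H : G.Term} {i : ℕ}
    (hH : H ≠ var i) :
    H.subst (Function.update σ i (var 0)) ≠ var 0 ∧
      (H.subst (Function.update σ i (var 0))).lim 0 = (H.lim i).subst σ := by
  have hne : H.subst (Function.update σ i (var 0)) ≠ var 0 := by
    rcases H.exists_label_nil with ⟨j, rfl⟩ | ⟨X, hX⟩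
    · have hj : j ≠ i := by rintro rfl; exact hH rfl
      rw [var_subst, Function.update_of_ne hj]
      exact (hσ j).ne_var 0
    · intro h
      have := subst_label_nil hX (Function.update σ i (var 0))
      rw [h] at this
      simp [var] at this
  refine ⟨hne, (eq_lim hne ?_).symm⟩
  have h1 := inst_subst_update hσ H ((H.lim i).subst σ) i
  rw [RegTerm.inst] at h1
  rw [h1]
  conv_lhs => rw [lim_eq hH, subst_subst]
  congr 1
  funext j
  by_cases hj : j = i
  · subst hj; simp
  · simp [Function.update_of_ne hj]

/-- The replacement takes place at the level of patterns: σ is unchanged, while the variable `i`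
disappears from `E`. -/
theorem Models.replace_lim {B : Set (G.Term × G.Term)} {T₀ U₀ : G.Term} {σ : ℕ → G.Term}
    (hσ : ∀ j, (σ j).IsGround) {u w : List A} {E H U : G.Term} {i : ℕ}
    (h : G.Models B T₀ U₀ u (.pair (E.subst σ) U)) (hw : w.length < u.length)
    (hH : H ≠ var i) (h' : G.Models B T₀ U₀ w (.pair (σ i) (H.subst σ))) :
    G.Models B T₀ U₀ u
      (.pair ((E.subst (Function.update var i (H.lim i))).subst σ) U) := by
  obtain ⟨h1, h2⟩ := subst_lim hσ hH
  have := h.replace hσ (i := i) hw (subst_update_varsBelow hσ H i) h1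
    (by rwa [inst_subst_update hσ, Function.update_eq_self])
  rw [h2] at this
  rw [subst_subst]
  convert this using 4
  rename_i j
  by_cases hj : j = i
  · subst hj; simp
  · simp [Function.update_of_ne hj]

theorem Models.replace_all {B : Set (G.Term × G.Term)} {T₀ U₀ : G.Term} {σ ρ : ℕ → G.Term}
    (hσ : ∀ j, (σ j).IsGround) (hρ : ∀ j, (ρ j).IsGround) {u : List A} {E U : G.Term} {n : ℕ}
    (hE : E.VarsBelow n) (h : G.Models B T₀ U₀ u (.pair (E.subst σ) U))
    (h' : ∀ j < n, ∃ w : List A, w.length < u.length ∧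
      G.Models B T₀ U₀ w (.pair (σ j) (ρ j))) :
    G.Models B T₀ U₀ u (.pair (E.subst ρ) U) := by
  -- The variables are replaced one after the other, all at the same word `u`.
  have key : ∀ k ≤ n,
      G.Models B T₀ U₀ u (.pair (E.subst fun j => if j < k then ρ j else σ j) U) := by
    intro k
    induction k with
    | zero => simpa using h
    | succ k ih =>
      intro hk
      obtain ⟨w, hw, h1⟩ := h' k hk
      have hg : ∀ j, (if j < k then ρ j else σ j : G.Term).IsGround := fun j => by
        split_ifs
        exacts [hρ j, hσ j]
      have := (ih (by omega)).replace_ground hg (i := k) hw (hρ k) (by simpa using h1)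
      convert this using 4
      rename_i j
      by_cases hj : j = k
      · subst hj; simp
      · rw [Function.update_of_ne hj]
        have : j < k + 1 ↔ j < k := by omega
        simp only [this]
  have h1 : E.subst (fun j => if j < n then ρ j else σ j) = E.subst ρ :=
    subst_congr (D := {j | j < n}) hE fun j hj => if_pos hj
  exact h1 ▸ key n le_rfl

/-! ### Sequences of pairs with a common tail -/

theorem IsSound.iUnion {ι : Type*} {B : ι → Set (G.Term × G.Term)}
    (h : ∀ i, G.IsSound (B i)) : G.IsSound (⋃ i, B i) := by
  rintro p ⟨E, F, hEF, σ, hσ, rfl⟩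
  obtain ⟨i, hi⟩ := Set.mem_iUnion.1 hEF
  exact h i _ ⟨E, F, hi, σ, hσ, rfl⟩

/-- A pair of `B` has an instance in each sequence of derived pairs `(Eⱼσ, Fⱼσ)` where `(Eⱼ, Fⱼ)`
belongs to `S j` and the length of the words increases. -/
def Covers (G : Grammar N A) (B : Set (G.Term × G.Term)) (S : ℕ → Set (G.Term × G.Term)) :
    Prop :=
  ∀ (B' : Set (G.Term × G.Term)) (T₀ U₀ : G.Term), G.lts.TraceEquiv T₀ U₀ →
    ∀ σ : ℕ → G.Term, (∀ j, (σ j).IsGround) →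
    ∀ u : ℕ → List A, StrictMono (fun j => (u j).length) →
    (∀ j, ∃ p ∈ S j, G.Models B' T₀ U₀ (u j) (.pair (p.1.subst σ) (p.2.subst σ))) →
    ∃ j, ∃ p ∈ B, G.Models B' T₀ U₀ (u j) (.pair (p.1.subst σ) (p.2.subst σ))

/-- The first pair of a sequence can be fixed in advance, at the price of a union over `S 0`. -/
theorem Covers.of_first {S : ℕ → Set (G.Term × G.Term)} {B : G.Term × G.Term → Set _}
    (h : ∀ p ∈ S 0, G.Covers (B p) (Function.update S 0 {p})) :
    G.Covers (⋃ p : S 0, B p) S := by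
  intro B' T₀ U₀ h0 σ hσ u hu hS
  obtain ⟨p, hp, h1⟩ := hS 0
  obtain ⟨j, q, hq, h2⟩ := h p hp B' T₀ U₀ h0 σ hσ u hu fun j => by
    by_cases hj : j = 0
    · subst hj
      exact ⟨p, by simp, h1⟩
    · simpa [Function.update_of_ne hj] using hS j
  exact ⟨j, q, Set.mem_iUnion.2 ⟨⟨p, hp⟩, hq⟩, h2⟩

theorem exists_exposing_word_of_not_isSound (hdet : G.IsDeterministic) {p : G.Term × G.Term}
    (hp : ¬ G.IsSound {p}) {σ : ℕ → G.Term}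
    (h : G.lts.TraceEquiv (p.1.subst σ) (p.2.subst σ)) :
    ∃ x i H, H ≠ var i ∧ ((G.lts.Reach p.1 x (var i) ∧ G.lts.Reach p.2 x H) ∨
        (G.lts.Reach p.2 x (var i) ∧ G.lts.Reach p.1 x H)) := by
  unfold IsSound at hp
  push Not at hp
  obtain ⟨_, ⟨E, F, hEF, τ, _, rfl⟩, h1⟩ := hp
  obtain rfl : (E, F) = p := hEF
  obtain ⟨w, hw⟩ : ∃ w, ¬ (w ∈ G.lts.traces (E.subst τ) ↔ w ∈ G.lts.traces (F.subst τ)) := by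
    by_contra hc
    push Not at hc
    exact h1 (Set.ext hc)
  by_cases hE : w ∈ G.lts.traces (E.subst τ)
  · exact exists_exposing_word hdet h hE fun hF => hw (iff_of_true hE hF)
  · obtain ⟨x, i, H, hH, h2⟩ := exists_exposing_word hdet h.symm
      (by by_contra hF; exact hw (iff_of_false hE hF)) hE
    exact ⟨x, i, H, hH, h2.symm⟩

/-- Once `σ i ∼ Hσ` is derived, the variable `i` can be eliminated from the later pairs. -/
theorem Covers.of_eliminate (hdet : G.IsDeterministic) {S : ℕ → Set (G.Term × G.Term)}
    {B : Set (G.Term × G.Term)} {p : G.Term × G.Term} {x : List A} {i : ℕ} {H : G.Term}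
    (hp : ∀ q ∈ S 0, q = p) (hH : H ≠ var i)
    (hx : (G.lts.Reach p.1 x (var i) ∧ G.lts.Reach p.2 x H) ∨
      (G.lts.Reach p.2 x (var i) ∧ G.lts.Reach p.1 x H))
    (hB : G.Covers B fun j => (fun q : G.Term × G.Term =>
      (q.1.subst (Function.update var i (H.lim i)),
        q.2.subst (Function.update var i (H.lim i)))) '' S (j + (x.length + 1))) :
    G.Covers B S := by
  intro B' T₀ U₀ h0 σ hσ u hu hS
  obtain ⟨q, hq, h1⟩ := hS 0
  obtain rfl := hp q hq
  have h2 : G.Models B' T₀ U₀ (u 0 ++ x) (.pair (σ i) (H.subst σ)) := by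
    rcases hx with ⟨h3, h4⟩ | ⟨h3, h4⟩
    · simpa using h1.reach hdet h0 (reach_subst h3 σ) (reach_subst h4 σ)
    · simpa using h1.symmetry.reach hdet h0 (reach_subst h3 σ) (reach_subst h4 σ)
  have hlen : ∀ j, (u 0).length + j ≤ (u j).length := by
    intro j
    induction j with
    | zero => simp
    | succ j ih =>
      have := hu (Nat.lt_add_one j)
      simp only at this
      omega
  -- The equation labels a word of length `(u 0).length + x.length`. Lengths grow by at least one
  -- per index, so from index `x.length + 1` on it labels a strictly shorter word, as replacement
  -- requires.
  obtain ⟨j, r, hr, h3⟩ := hB B' T₀ U₀ h0 σ hσ (fun j => u (j + (x.length + 1)))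
    (fun j k hjk => hu (by simpa using hjk)) (fun j => by
      obtain ⟨r, hr, h3⟩ := hS (j + (x.length + 1))
      have hw : (u 0 ++ x).length < (u (j + (x.length + 1))).length := by
        have := hlen (j + (x.length + 1))
        rw [List.length_append]
        omega
      exact ⟨_, ⟨r, hr, rfl⟩,
        ((h3.replace_lim hσ hw hH h2).symmetry.replace_lim hσ hw hH h2).symmetry⟩)
  exact ⟨_, r, hr, h3⟩

/-- Strong induction on the set of variables. The set `B` is fixed before the initial pair, the
substitution and the words; this is possible because the exposing word and the term `H` depend on
the pattern `p` alone. -/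
theorem exists_sound_covers (hdet : G.IsDeterministic) (D : Finset ℕ) :
    ∀ S : ℕ → Set (G.Term × G.Term), (∀ j, (S j).Finite) →
      (∀ j, ∀ p ∈ S j, p.1.VarsIn D ∧ p.2.VarsIn D) →
      ∃ B : Set (G.Term × G.Term), B.Finite ∧ G.IsSound B ∧ G.Covers B S := by
  induction D using Finset.strongInduction with
  | H D ih =>
    intro S hfin hvars
    have key : ∀ p, ∃ B : Set (G.Term × G.Term), p ∈ S 0 →
        B.Finite ∧ G.IsSound B ∧ G.Covers B (Function.update S 0 {p}) := by
      intro p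
      by_cases hp : p ∈ S 0
      swap
      · exact ⟨∅, fun h => absurd h hp⟩
      by_cases hsound : G.IsSound {p}
      · refine ⟨{p}, fun _ => ⟨Set.finite_singleton _, hsound, ?_⟩⟩
        intro B' T₀ U₀ h0 σ hσ u hu hS
        obtain ⟨q, hq, h1⟩ := hS 0
        exact ⟨0, q, by simpa using hq, h1⟩
      -- A pair with no equivalent instance is never derived from equivalent terms, so nothing is
      -- needed for it.
      by_cases heq : ∃ σ : ℕ → G.Term, G.lts.TraceEquiv (p.1.subst σ) (p.2.subst σ)
      swap
      · refine ⟨∅, fun _ => ⟨Set.finite_empty, ?_, ?_⟩⟩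
        · rintro q ⟨E, F, hEF, _⟩
          exact absurd hEF (Set.notMem_empty _)
        · intro B' T₀ U₀ h0 σ hσ u hu hS
          obtain ⟨q, hq, h1⟩ := hS 0
          obtain rfl : q = p := by simpa using hq
          exact absurd ⟨σ, h1.traceEquiv hdet h0⟩ heq
      -- This σ serves only to find the exposing word; the equation is later used under every σ.
      -- Without variables no such word exists, which ends the induction.
      obtain ⟨σ, hσ⟩ := heq
      obtain ⟨x, i, H, hH, hx⟩ := exists_exposing_word_of_not_isSound hdet hsound hσ
      have hiH : i ∈ D ∧ H.VarsIn D := by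
        rcases hx with ⟨h1, h2⟩ | ⟨h1, h2⟩
        · exact ⟨reach_varsIn h1 (hvars 0 p hp).1 [] i rfl, reach_varsIn h2 (hvars 0 p hp).2⟩
        · exact ⟨reach_varsIn h1 (hvars 0 p hp).2 [] i rfl, reach_varsIn h2 (hvars 0 p hp).1⟩
      have hθ : ∀ j ∈ (D : Set ℕ),
          (Function.update var i (H.lim i) j : G.Term).VarsIn (D.erase i : Finset ℕ) := by
        intro j hj
        by_cases hji : j = i
        · subst hji
          rw [Function.update_self]
          exact (lim_varsIn hH hiH.2).mono (by simp)
        · rw [Function.update_of_ne hji]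
          exact var_varsIn (by simpa [hji] using hj)
      obtain ⟨B, h1, h2, h3⟩ := ih (D.erase i) (Finset.erase_ssubset hiH.1)
        (fun j => (fun q : G.Term × G.Term =>
          (q.1.subst (Function.update var i (H.lim i)),
            q.2.subst (Function.update var i (H.lim i)))) '' S (j + (x.length + 1)))
        (fun j => (hfin _).image _) (by
          rintro j _ ⟨q, hq, rfl⟩
          exact ⟨(hvars _ q hq).1.subst hθ, (hvars _ q hq).2.subst hθ⟩)
      refine ⟨B, fun _ => ⟨h1, h2, Covers.of_eliminate (p := p) hdet (by simp) hH hx ?_⟩⟩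
      simpa [Function.update_of_ne] using h3
    choose B hB using key
    have := (hfin 0).to_subtype
    exact ⟨⋃ p : S 0, B p, Set.finite_iUnion fun p => (hB p p.2).1,
      IsSound.iUnion fun p => (hB p p.2).2.1, Covers.of_first fun p hp => (hB p hp).2.2⟩

end Grammar
/-! ### Infinite words and paths -/

/-- The factor of length `k` starting at position `t` of the infinite word `α`. -/
def seg {A : Type v} (α : ℕ → A) (t : ℕ) : ℕ → List A
  | 0 => []
  | k + 1 => seg α t k ++ [α (t + k)]

@[simp]
theorem seg_length {A : Type v} (α : ℕ → A) (t k : ℕ) : (seg α t k).length = k := by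
  induction k with
  | zero => rfl
  | succ k ih => simp [seg, ih]

theorem seg_add {A : Type v} (α : ℕ → A) (t k l : ℕ) :
    seg α t (k + l) = seg α t k ++ seg α (t + k) l := by
  induction l with
  | zero => simp [seg]
  | succ l ih => rw [← Nat.add_assoc, seg, ih, seg, List.append_assoc, Nat.add_assoc]

theorem seg_shift {A : Type v} (α : ℕ → A) (t p k : ℕ) :
    seg (fun n => α (t + n)) p k = seg α (t + p) k := by
  induction k with
  | zero => rfl
  | succ k ih => rw [seg, seg, ih, Nat.add_assoc]

theorem eq_seg_of_append {A : Type v} {α : ℕ → A} {t k : ℕ} {x y : List A}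
    (h : seg α t k = x ++ y) :
    x = seg α t x.length ∧ y = seg α (t + x.length) y.length ∧ k = x.length + y.length := by
  have hk : k = x.length + y.length := by simpa using congrArg List.length h
  rw [hk, seg_add] at h
  obtain ⟨h1, h2⟩ := List.append_inj h (by simp)
  exact ⟨h1.symm, h2.symm, hk⟩

namespace Grammar

open RegTerm

variable {N : Type u} {A : Type v} {G : Grammar N A}

/-- `Q` is an infinite path with the labels `β`. -/
def IsPath (G : Grammar N A) (β : ℕ → A) (Q : ℕ → G.Term) : Prop :=
  ∀ p, G.lts.step (Q p) (β p) (Q (p + 1))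

theorem IsPath.reach {β : ℕ → A} {Q : ℕ → G.Term} (h : G.IsPath β Q) (p k : ℕ) :
    G.lts.Reach (Q p) (seg β p k) (Q (p + k)) := by
  induction k with
  | zero => rfl
  | succ k ih => exact (LTS.reach_append _).2 ⟨_, ih, (LTS.reach_singleton _).2 (h _)⟩

theorem exists_isPath (hdet : G.IsDeterministic) {β : ℕ → A} {T : G.Term}
    (h : ∀ k, seg β 0 k ∈ G.lts.traces T) : ∃ Q, Q 0 = T ∧ G.IsPath β Q := by
  choose Q hQ using h
  refine ⟨Q, (show T = Q 0 from hQ 0).symm, fun p => ?_⟩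
  have := reach_of_append hdet (hQ p) (hQ (p + 1))
  rw [LTS.reach_singleton] at this
  simpa using this

/-- No root successor of `T` is exposed by a proper initial factor of `w`. -/
def Persists (G : Grammar N A) (T : G.Term) (w : List A) : Prop :=
  ∃ X E, T.label [] = some (Sum.inl X) ∧ G.lts.Reach (flat X) w E

/-- A root successor of `T` is exposed by a proper initial factor of `w`. -/
def Sinks (G : Grammar N A) (T : G.Term) (w : List A) : Prop :=
  ∃ X x y i, T.label [] = some (Sum.inl X) ∧ w = x ++ y ∧ y ≠ [] ∧
    G.lts.Reach (flat X) x (var i)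

theorem reach_child {T : G.Term} {X : N} (hX : T.label [] = some (Sum.inl X)) {x : List A}
    {i : ℕ} (h : G.lts.Reach (flat X) x (var i)) : G.lts.Reach T x (T.child i) := by
  have := reach_subst h T.child
  rwa [← eq_flat_subst hX, var_subst] at this

theorem persists_or_sinks {T T' : G.Term} {X : N} (hX : T.label [] = some (Sum.inl X))
    {w : List A} (h : G.lts.Reach T w T') : G.Persists T w ∨ G.Sinks T w := by
  rw [eq_flat_subst hX] at h
  rcases reach_subst_inv h with ⟨E, h1, _⟩ | ⟨x, y, i, h1, h2, h3, _⟩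
  · exact Or.inl ⟨X, E, hX, h1⟩
  · exact Or.inr ⟨X, x, y, i, hX, h1, h2, h3⟩

theorem Sinks.exists_child (hdet : G.IsDeterministic) {β : ℕ → A} {Q : ℕ → G.Term}
    (hQ : G.IsPath β Q) {p k : ℕ} (h : G.Sinks (Q p) (seg β p k)) :
    ∃ X q i, (Q p).label [] = some (Sum.inl X) ∧ 0 < q ∧ q < k ∧
      G.lts.Reach (flat X) (seg β p q) (var i) ∧ Q (p + q) = (Q p).child i := by
  obtain ⟨X, x, y, i, hX, h1, h2, h3⟩ := h
  obtain ⟨h4, _, h5⟩ := eq_seg_of_append h1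
  have hy := List.length_pos_iff.2 h2
  have hx := List.length_pos_iff.2 (ne_nil_of_reach_flat h3)
  refine ⟨X, x.length, i, hX, hx, by omega, h4 ▸ h3, ?_⟩
  have h6 := hQ.reach p x.length
  rw [← h4] at h6
  exact reach_det hdet h6 (reach_child hX h3)

/-- A path that keeps sinking visits only finitely many terms. -/
theorem finite_range_of_sinks (hdet : G.IsDeterministic) {β : ℕ → A} {Q : ℕ → G.Term}
    (hQ : G.IsPath β Q) {M : ℕ} (h : ∀ p, G.Sinks (Q p) (seg β p M)) :
    (Set.range Q).Finite := by
  refine ((Q 0).subterms_finite.biUnion fun V _ => G.reachSet_finite M V).subset ?_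
  -- Each position lies at most M steps after a visit to a subterm of the first term: when the M
  -- steps are used up, sinking supplies a later visit.
  have key : ∀ p, ∃ q k, p = q + k ∧ k ≤ M ∧ Q q ∈ (Q 0).subterms := by
    intro p
    induction p with
    | zero => exact ⟨0, 0, rfl, Nat.zero_le _, self_mem_subterms _⟩
    | succ p ih =>
      obtain ⟨q, k, hp, hk, hq⟩ := ih
      by_cases hkM : k < M
      · exact ⟨q, k + 1, by omega, by omega, hq⟩
      · obtain ⟨X, r, i, hX, hr0, hr, hri, hQr⟩ := (h q).exists_child hdet hQ
        exact ⟨q + r, k + 1 - r, by omega, by omega, hQr ▸ child_mem_subterms hq i⟩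
  rintro _ ⟨p, rfl⟩
  obtain ⟨q, k, rfl, hk, hq⟩ := key p
  exact Set.mem_biUnion hq ⟨seg β q k, by simpa using hk, hQ.reach q k⟩

/-! ### Infinite words without success -/

/-- No initial factor of the infinite word `α`, enabled in `T₀ ∼ U₀`, is labelled with success. -/
structure Stuck (G : Grammar N A) (B : Set (G.Term × G.Term)) (T₀ U₀ : G.Term)
    (α : ℕ → A) : Prop where
  equiv : G.lts.TraceEquiv T₀ U₀
  ground_left : T₀.IsGround
  ground_right : U₀.IsGround
  enabled : ∀ t, seg α 0 t ∈ G.lts.traces T₀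
  not_success : ∀ t, ¬ G.Models B T₀ U₀ (seg α 0 t) .success

/-- Progression read backwards: an enabled word without success has an enabled one-letter extension
without success. A word that enables nothing further would satisfy progression vacuously. -/
theorem exists_stuck (hdet : G.IsDeterministic) {B : Set (G.Term × G.Term)} {T₀ U₀ : G.Term}
    (h0 : G.lts.TraceEquiv T₀ U₀) (hT : T₀.IsGround) (hU : U₀.IsGround)
    (h : ¬ G.Models B T₀ U₀ [] .success) : ∃ α, G.Stuck B T₀ U₀ α := by
  let P : List A → Prop := fun u => u ∈ G.lts.traces T₀ ∧ ¬ G.Models B T₀ U₀ u .success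
  have hstep : ∀ u : {u // P u}, ∃ a, P (u.1 ++ [a]) := by
    rintro ⟨u, ⟨T, hTu⟩, hu⟩
    obtain ⟨U, hUu, hTU⟩ := TraceEquiv.exists_reach hdet h0 hTu
    have hm : G.Models B T₀ U₀ u (.pair T U) := by
      simpa using (Models.start (B := B)).reach hdet h0 hTu hUu
    by_contra hc
    push Not at hc
    refine hu (.progression hm (hTU.upTo 1) ?_)
    rintro a ⟨T', hT'⟩
    by_contra hs
    exact hc a ⟨⟨T', (LTS.reach_append _).2 ⟨T, hTu, (LTS.reach_singleton _).2 hT'⟩⟩, hs⟩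
  choose a ha using hstep
  let word : ℕ → {u // P u} := fun n =>
    Nat.rec ⟨[], LTS.nil_mem_traces _ _, h⟩ (fun _ u => ⟨u.1 ++ [a u], ha u⟩) n
  have hword : ∀ n, seg (fun n => a (word n)) 0 n = (word n).1 := by
    intro n
    induction n with
    | zero => rfl
    | succ n ih => rw [seg, ih, Nat.zero_add]
  exact ⟨fun n => a (word n), h0, hT, hU, fun t => hword t ▸ (word t).2.1,
    fun t => hword t ▸ (word t).2.2⟩

namespace Stuck

variable {B : Set (G.Term × G.Term)} {T₀ U₀ : G.Term} {α : ℕ → A}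

theorem mem_traces (hdet : G.IsDeterministic) (hs : G.Stuck B T₀ U₀ α) {t : ℕ} {T U : G.Term}
    (h : G.Models B T₀ U₀ (seg α 0 t) (.pair T U)) (k : ℕ) : seg α t k ∈ G.lts.traces T := by
  obtain ⟨T', h1, h2, _⟩ := h.exists_reach_traceEquiv hdet hs.equiv
  obtain ⟨T'', h3⟩ := hs.enabled (t + k)
  rw [seg_add, Nat.zero_add] at h3
  exact h2.subset ⟨T'', reach_of_append hdet h1 h3⟩

theorem exists_path (hdet : G.IsDeterministic) (hs : G.Stuck B T₀ U₀ α) {t : ℕ} {T U : G.Term}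
    (h : G.Models B T₀ U₀ (seg α 0 t) (.pair T U)) :
    ∃ Q, Q 0 = T ∧ G.IsPath (fun k => α (t + k)) Q :=
  exists_isPath hdet fun k => by simpa [seg_shift] using hs.mem_traces hdet h k

theorem models_seg (hdet : G.IsDeterministic) (hs : G.Stuck B T₀ U₀ α) {t k : ℕ}
    {T U T' U' : G.Term} (h : G.Models B T₀ U₀ (seg α 0 t) (.pair T U))
    (hT : G.lts.Reach T (seg α t k) T') (hU : G.lts.Reach U (seg α t k) U') :
    G.Models B T₀ U₀ (seg α 0 (t + k)) (.pair T' U') := by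
  rw [seg_add, Nat.zero_add]
  exact h.reach hdet hs.equiv hT hU

/-- No pair is repeated. -/
theorem not_repeat (hs : G.Stuck B T₀ U₀ α) (hB : ((var 0 : G.Term), (var 0 : G.Term)) ∈ B)
    {s t : ℕ} (hst : s < t) {T U : G.Term}
    (h₁ : G.Models B T₀ U₀ (seg α 0 s) (.pair T U))
    (h₂ : G.Models B T₀ U₀ (seg α 0 t) (.pair T U)) : False := by
  obtain ⟨hT, hU⟩ := h₁.isGround hs.ground_left hs.ground_right
  have h3 : G.Models B T₀ U₀ (seg α 0 t) (.pair ((var 0).subst fun _ => T) U) := by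
    rwa [var_subst]
  -- The earlier pair turns the left side of the later one into `U`, which leaves (U, U).
  have h4 := h3.replace_ground (fun _ => hT) (i := 0) (by simpa using hst) hU h₁
  rw [var_subst, Function.update_self] at h4
  refine hs.not_success t (.basis ?_ h4 ⟨_, _, hB, fun _ => U, fun _ => hU, by simp⟩)
  intro h
  have := congrArg List.length h
  rw [seg_length, List.length_nil] at this
  omega

/-- From each derived pair one gets to a pair one side of which does not sink. -/
theorem exists_persists (hdet : G.IsDeterministic) (hs : G.Stuck B T₀ U₀ α)
    (hB : ((var 0 : G.Term), (var 0 : G.Term)) ∈ B) {t : ℕ} {T U : G.Term}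
    (h : G.Models B T₀ U₀ (seg α 0 t) (.pair T U)) (M : ℕ) :
    ∃ k T' U', G.lts.Reach T (seg α t k) T' ∧ G.lts.Reach U (seg α t k) U' ∧
      (G.Persists T' (seg α (t + k) M) ∨ G.Persists U' (seg α (t + k) M)) ∧
      ∀ l < k, ∀ T' U', G.lts.Reach T (seg α t l) T' → G.lts.Reach U (seg α t l) U' →
        G.Sinks T' (seg α (t + l) M) ∧ G.Sinks U' (seg α (t + l) M) := by
  classical
  obtain ⟨Q, rfl, hQ⟩ := hs.exists_path hdet h
  obtain ⟨R, rfl, hR⟩ := hs.exists_path hdet h.symmetry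
  have hQr : ∀ p k, G.lts.Reach (Q p) (seg α (t + p) k) (Q (p + k)) := fun p k =>
    seg_shift α t p k ▸ hQ.reach p k
  have hRr : ∀ p k, G.lts.Reach (R p) (seg α (t + p) k) (R (p + k)) := fun p k =>
    seg_shift α t p k ▸ hR.reach p k
  have hm : ∀ k, G.Models B T₀ U₀ (seg α 0 (t + k)) (.pair (Q k) (R k)) := fun k =>
    hs.models_seg hdet h (by simpa using hQr 0 k) (by simpa using hRr 0 k)
  -- Otherwise both sides sink everywhere, so each path has finite range and some pair occurs twice.
  have hex : ∃ k, G.Persists (Q k) (seg α (t + k) M) ∨ G.Persists (R k) (seg α (t + k) M) := by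
    by_contra hc
    push Not at hc
    have h1 : ∀ p, G.Sinks (Q p) (seg α (t + p) M) := fun p => by
      obtain ⟨X, hX⟩ := ((hm p).isGround hs.ground_left hs.ground_right).1.exists_label_nil
      exact (persists_or_sinks hX (hQr p M)).resolve_left (hc p).1
    have h2 : ∀ p, G.Sinks (R p) (seg α (t + p) M) := fun p => by
      obtain ⟨X, hX⟩ := ((hm p).isGround hs.ground_left hs.ground_right).2.exists_label_nil
      exact (persists_or_sinks hX (hRr p M)).resolve_left (hc p).2
    have h3 := finite_range_of_sinks hdet hQ (M := M) fun p => by rw [seg_shift]; exact h1 p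
    have h4 := finite_range_of_sinks hdet hR (M := M) fun p => by rw [seg_shift]; exact h2 p
    obtain ⟨a, b, hab, heq⟩ := Set.Finite.exists_lt_map_eq_of_forall_mem
      (f := fun k => (Q k, R k)) (t := Set.range Q ×ˢ Set.range R)
      (fun k => ⟨⟨k, rfl⟩, ⟨k, rfl⟩⟩) (h3.prod h4)
    simp only [Prod.mk.injEq] at heq
    refine hs.not_repeat hB (s := t + a) (t := t + b) (by omega) (hm a) ?_
    rw [heq.1, heq.2]
    exact hm b
  refine ⟨Nat.find hex, Q _, R _, by simpa using hQr 0 (Nat.find hex),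
    by simpa using hRr 0 (Nat.find hex), Nat.find_spec hex, fun l hl T' U' hT' hU' => ?_⟩
  have hQ' : G.lts.Reach (Q 0) (seg α t l) (Q l) := by simpa using hQr 0 l
  have hR' : G.lts.Reach (R 0) (seg α t l) (R l) := by simpa using hRr 0 l
  obtain rfl := reach_det hdet hT' hQ'
  obtain rfl := reach_det hdet hU' hR'
  have hmin := Nat.find_min hex hl
  push Not at hmin
  obtain ⟨h1, h2⟩ := (hm l).isGround hs.ground_left hs.ground_right
  obtain ⟨X, hX⟩ := h1.exists_label_nil
  obtain ⟨Y, hY⟩ := h2.exists_label_nil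
  exact ⟨(persists_or_sinks hX (hQr l M)).resolve_left hmin.1,
    (persists_or_sinks hY (hRr l M)).resolve_left hmin.2⟩

end Stuck

/-! ### Pivots -/

/-- Every root successor can be exposed by a word shorter than `M`. -/
def ExposedWithin (G : Grammar N A) (M : ℕ) : Prop :=
  ∀ X, ∀ i < G.arity X, ∃ w : List A, w.length < M ∧ G.lts.Reach (flat X) w (var i)

theorem exists_exposedWithin [Finite N] (hnf : G.IsNormalForm) :
    ∃ M, 0 < M ∧ G.ExposedWithin M := by
  choose w hw using hnf
  obtain ⟨m, hm⟩ := (Set.finite_range fun p : Σ X, Fin (G.arity X) =>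
    (w p.1 p.2).length).bddAbove
  exact ⟨m + 1, Nat.succ_pos _, fun X i hi =>
    ⟨w X ⟨i, hi⟩, Nat.lt_succ_of_le (hm ⟨⟨X, ⟨i, hi⟩⟩, rfl⟩), hw X ⟨i, hi⟩⟩⟩

/-- `W` is a pivot at `t`: it occurs there in a derived pair the other side of which does not sink
within `M` steps. -/
def Pivot (G : Grammar N A) (B : Set (G.Term × G.Term)) (T₀ U₀ : G.Term) (α : ℕ → A) (M t : ℕ)
    (W : G.Term) : Prop :=
  ∃ Z, G.Models B T₀ U₀ (seg α 0 t) (.pair Z W) ∧ G.Persists Z (seg α t M)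

namespace Stuck

variable {B : Set (G.Term × G.Term)} {T₀ U₀ : G.Term} {α : ℕ → A} {M : ℕ}

/-- The context `E` survives for M steps above the successors of `Z`. The word exposing a successor
of `Z`, followed on the side of `W`, ends in an equivalent term; having fewer than M letters, it
labels that pair early enough for replacement at `t + M`. The exposing words need not follow α. -/
theorem exists_balanced (hdet : G.IsDeterministic) (hs : G.Stuck B T₀ U₀ α)
    (hM : G.ExposedWithin M) {t : ℕ} {W : G.Term} (h : G.Pivot B T₀ U₀ α M t W) :
    ∃ (X : N) (E W' : G.Term) (ρ : ℕ → G.Term), G.lts.Reach (flat X) (seg α t M) E ∧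
      G.lts.Reach W (seg α t M) W' ∧ (∀ j, (ρ j).IsGround) ∧
      (∀ j < G.arity X, ∃ w : List A, w ≠ [] ∧ w.length < M ∧ G.lts.Reach W w (ρ j)) ∧
      G.Models B T₀ U₀ (seg α 0 (t + M)) (.pair (E.subst ρ) W') := by
  obtain ⟨Z, hZ, X, E, hX, hE⟩ := h
  obtain ⟨hZg, hWg⟩ := hZ.isGround hs.ground_left hs.ground_right
  obtain ⟨W', hW'⟩ := hs.mem_traces hdet hZ.symmetry M
  have key : ∀ j, ∃ V : G.Term, V.IsGround ∧ (j < G.arity X →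
      ∃ w : List A, w ≠ [] ∧ w.length < M ∧ G.lts.Reach W w V ∧
        G.lts.Reach Z w (Z.child j)) := by
    intro j
    by_cases hj : j < G.arity X
    · obtain ⟨w, hw, hwr⟩ := hM X j hj
      have h1 := reach_child hX hwr
      obtain ⟨V, hV, _⟩ := TraceEquiv.exists_reach hdet (hZ.traceEquiv hdet hs.equiv) h1
      exact ⟨V, reach_isGround hV hWg, fun _ => ⟨w, ne_nil_of_reach_flat hwr, hw, hV, h1⟩⟩
    -- Beyond the arity any ground term will do.
    · exact ⟨W, hWg, fun h => absurd h hj⟩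
  choose ρ hρ hρ' using key
  refine ⟨X, E, W', ρ, hE, hW', hρ, fun j hj => ?_, ?_⟩
  · obtain ⟨w, h1, h2, h3, _⟩ := hρ' j hj
    exact ⟨w, h1, h2, h3⟩
  · have h1 : G.lts.Reach Z (seg α t M) (E.subst Z.child) := by
      have := reach_subst hE Z.child
      rwa [← eq_flat_subst hX] at this
    refine (hs.models_seg hdet hZ h1 hW').replace_all (fun j => hZg.child j) hρ
      (n := G.arity X) (reach_varsIn hE (flat_varsIn X)) fun j hj => ?_
    obtain ⟨w, _, h2, h3, h4⟩ := hρ' j hj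
    exact ⟨seg α 0 t ++ w, by simpa using h2, hZ.reach hdet hs.equiv h4 h3⟩

/-- Within a number of steps bounded by the height of `E`, the term `Eρ` either sinks to an
instance of a variable or stops sinking. -/
theorem exists_var_or_persists (hdet : G.IsDeterministic) {h : ℕ} :
    ∀ {E : G.Term} {t : ℕ}, E.HeightLE h → ∀ {ρ : ℕ → G.Term},
      (∀ k, seg α t k ∈ G.lts.traces (E.subst ρ)) →
      ∃ q ≤ h * M, ∃ E', G.lts.Reach E (seg α t q) E' ∧
        ((∃ i, E' = var i) ∨ G.Persists E' (seg α (t + q) M)) := by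
  induction h with
  | zero =>
    intro E t hE ρ hρ
    refine ⟨0, Nat.zero_le _, E, rfl, ?_⟩
    rcases E.exists_label_nil with hi | ⟨X, hX⟩
    · exact Or.inl hi
    · obtain ⟨T', hT'⟩ := hρ M
      rcases persists_or_sinks (subst_label_nil hX ρ) hT' with ⟨Y, F, hY, hF⟩ |
        ⟨Y, x, y, i, hY, _, _, hx⟩
      · obtain rfl : X = Y := by simpa using (subst_label_nil hX ρ).symm.trans hY
        exact Or.inr ⟨X, F, hX, hF⟩
      · obtain rfl : X = Y := by simpa using (subst_label_nil hX ρ).symm.trans hY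
        exact absurd hE (not_heightLE_zero hX (lt_arity_of_reach hx))
  | succ h ih =>
    intro E t hE ρ hρ
    rcases E.exists_label_nil with hi | ⟨X, hX⟩
    · exact ⟨0, Nat.zero_le _, E, rfl, Or.inl hi⟩
    · obtain ⟨T', hT'⟩ := hρ M
      rcases persists_or_sinks (subst_label_nil hX ρ) hT' with ⟨Y, F, hY, hF⟩ |
        ⟨Y, x, y, i, hY, hxy, hy, hx⟩
      · obtain rfl : X = Y := by simpa using (subst_label_nil hX ρ).symm.trans hY
        exact ⟨0, Nat.zero_le _, E, rfl, Or.inr ⟨X, F, hX, hF⟩⟩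
      -- Sinking passes to a child in fewer than M steps and lowers the height by one, which
      -- accounts for the bound `h * M`.
      · obtain rfl : X = Y := by simpa using (subst_label_nil hX ρ).symm.trans hY
        obtain ⟨h1, _, h2⟩ := eq_seg_of_append hxy
        have h3 : G.lts.Reach E (seg α t x.length) (E.child i) := h1 ▸ reach_child hX hx
        obtain ⟨q, hq, E', h4, h5⟩ := ih (t := t + x.length)
          (hE.child hX (lt_arity_of_reach hx)) (ρ := ρ) fun k => by
            obtain ⟨T'', h4⟩ := hρ (x.length + k)
            rw [seg_add] at h4
            exact ⟨T'', reach_of_append hdet (reach_subst h3 ρ) h4⟩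
        refine ⟨x.length + q, ?_, E', ?_, ?_⟩
        · rw [Nat.succ_mul]; omega
        · rw [seg_add]
          exact (LTS.reach_append _).2 ⟨_, h3, h4⟩
        · rwa [← Nat.add_assoc]

/-- From each pivot a word leads to a later pivot; apart from a first part of bounded length, the
path keeps sinking. -/
theorem exists_next_pivot (hdet : G.IsDeterministic) (hs : G.Stuck B T₀ U₀ α)
    (hB : ((var 0 : G.Term), (var 0 : G.Term)) ∈ B) (hM0 : 0 < M) (hM : G.ExposedWithin M)
    {d : ℕ} (hd : ∀ X a E, (X, a, E) ∈ G.rules → E.HeightLE d) {t : ℕ} {W : G.Term}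
    (h : G.Pivot B T₀ U₀ α M t W) :
    ∃ (t' : ℕ) (W' V : G.Term) (x y : List A), t < t' ∧ G.Pivot B T₀ U₀ α M t' W' ∧ x ≠ [] ∧
      x.length ≤ M + (1 + M * d) * M ∧ G.lts.Reach W x V ∧ G.lts.Reach V y W' ∧
      ∀ y₁ y₂ y₃ C, y = y₁ ++ (y₂ ++ y₃) → y₂.length = M → G.lts.Reach V y₁ C →
        G.Sinks C y₂ := by
  obtain ⟨X, E, W₁, ρ, hE, hW₁, hρ, hρ', hm⟩ := hs.exists_balanced hdet hM h
  -- `flat X` has height 1 and each of the M steps adds at most `d`.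
  have hEh : E.HeightLE (1 + M * d) := by
    simpa using reach_heightLE hd hE (flat_heightLE X)
  obtain ⟨q, hq, E', hE', hcase⟩ := exists_var_or_persists (M := M) hdet hEh
    (hs.mem_traces hdet hm)
  obtain ⟨W₂, hW₂⟩ := hs.mem_traces hdet hm.symmetry q
  have hm₂ := hs.models_seg hdet hm (reach_subst hE' ρ) hW₂
  have hWW₂ : G.lts.Reach W (seg α t (M + q)) W₂ := by
    rw [seg_add]
    exact (LTS.reach_append _).2 ⟨_, hW₁, hW₂⟩
  have hne : seg α t (M + q) ≠ [] := by
    intro h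
    have := congrArg List.length h
    rw [seg_length, List.length_nil] at this
    omega
  have hlen : (seg α t (M + q)).length ≤ M + (1 + M * d) * M := by
    rw [seg_length]; omega
  rcases hcase with ⟨i, rfl⟩ | ⟨Y, F, hY, hF⟩
  · rw [var_subst] at hm₂
    have hi : i < G.arity X :=
      reach_varsIn hE' (reach_varsIn hE (flat_varsIn X)) [] i rfl
    obtain ⟨w, hw0, hwM, hw⟩ := hρ' i hi
    obtain ⟨k, T', U', hT', hU', hp, hmin⟩ := hs.exists_persists hdet hB hm₂ M
    have hm₃ := hs.models_seg hdet hm₂ hT' hU'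
    -- The side opposite to the persisting one becomes the pivot. The right side is reached from `W`
    -- along α; the left side descends from `ρ i`, which is reached from `W` by the exposing word
    -- `w`.
    rcases hp with hp | hp
    · refine ⟨t + M + q + k, U', W₂, _, seg α (t + M + q) k, by omega, ⟨T', hm₃, hp⟩, hne, hlen,
        hWW₂, hU', ?_⟩
      intro y₁ y₂ y₃ C hy hy₂ hC
      obtain ⟨h1, h2, h3⟩ := eq_seg_of_append hy
      obtain ⟨h4, _, _⟩ := eq_seg_of_append h2.symm
      rw [List.length_append, hy₂] at h3
      rw [hy₂] at h4
      obtain ⟨T'', hT''⟩ := hs.mem_traces hdet hm₂ y₁.length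
      rw [h1] at hC
      rw [h4]
      exact (hmin y₁.length (by omega) T'' C hT'' hC).2
    · refine ⟨t + M + q + k, T', ρ i, w, seg α (t + M + q) k, by omega, ⟨U', hm₃.symmetry, hp⟩,
        hw0, by omega, hw, hT', ?_⟩
      intro y₁ y₂ y₃ C hy hy₂ hC
      obtain ⟨h1, h2, h3⟩ := eq_seg_of_append hy
      obtain ⟨h4, _, _⟩ := eq_seg_of_append h2.symm
      rw [List.length_append, hy₂] at h3
      rw [hy₂] at h4
      obtain ⟨U'', hU''⟩ := hs.mem_traces hdet hm₂.symmetry y₁.length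
      rw [h1] at hC
      rw [h4]
      exact (hmin y₁.length (by omega) C U'' hC hU'').1
  -- The context itself stops sinking, so the right side is at once a pivot and the sinking part is
  -- empty.
  · refine ⟨t + M + q, W₂, W₂, _, [], by omega,
      ⟨_, hm₂, Y, F, subst_label_nil hY ρ, hF⟩, hne, hlen, hWW₂, rfl, ?_⟩
    intro y₁ y₂ y₃ C hy hy₂ _
    have := congrArg List.length hy
    simp only [List.length_append, List.length_nil] at this
    omega

end Stuck

end Grammar
-- Infinite concatenations of words
theorem seg_getElem {A : Type v} (α : ℕ → A) (t : ℕ) {k i : ℕ} (hi : i < (seg α t k).length) :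
    (seg α t k)[i] = α (t + i) := by
  induction k with
  | zero => simp at hi
  | succ k ih =>
    simp only [seg]
    by_cases h : i < k
    · rw [List.getElem_append_left (by simpa using h), ih]
    · obtain rfl : i = k := by simp at hi; omega
      rw [List.getElem_append_right (by simp)]
      simp

/-- An infinite concatenation of nonempty words is an infinite word. -/
theorem exists_concat {A : Type v} (v : ℕ → List A) (hv : ∀ n, v n ≠ []) :
    ∃ (β : ℕ → A) (s : ℕ → ℕ), s 0 = 0 ∧ StrictMono s ∧
      ∀ n, s (n + 1) = s n + (v n).length ∧ seg β (s n) (v n).length = v n := by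
  let word : ℕ → List A := fun n => Nat.rec [] (fun n w => w ++ v n) n
  have hsucc : ∀ n, word (n + 1) = word n ++ v n := fun n => rfl
  have hmono : StrictMono fun n => (word n).length := strictMono_nat_of_lt_succ fun n => by
    have := List.length_pos_iff.2 (hv n)
    simp only [hsucc, List.length_append]
    omega
  have hpre : ∀ n k, word n <+: word (n + k) := by
    intro n k
    induction k with
    | zero => exact List.prefix_rfl
    | succ k ih => exact ih.trans ⟨v (n + k), rfl⟩
  have hlt : ∀ p, p < (word (p + 1)).length := fun p =>
    Nat.lt_of_succ_le (hmono.le_apply (x := p + 1))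
  have hword : ∀ n, seg (fun p => (word (p + 1))[p]'(hlt p)) 0 (word n).length = word n := by
    intro n
    refine List.ext_getElem (by simp) fun i h1 h2 => ?_
    rw [seg_getElem]
    simp only [Nat.zero_add]
    rcases le_total n (i + 1) with h | h
    · obtain ⟨k, hk⟩ := Nat.exists_eq_add_of_le h
      have := hpre n k
      rw [← hk] at this
      exact (this.getElem h2).symm
    · obtain ⟨k, hk⟩ := Nat.exists_eq_add_of_le h
      have := hpre (i + 1) k
      rw [← hk] at this
      exact this.getElem (hlt i)
  refine ⟨fun p => (word (p + 1))[p]'(hlt p), fun n => (word n).length, rfl, hmono,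
    fun n => ⟨by simp [hsucc], ?_⟩⟩
  have h1 := hword (n + 1)
  have h2 : (word (n + 1)).length = (word n).length + (v n).length := by simp [hsucc]
  rw [h2, seg_add, hword n, hsucc, Nat.zero_add] at h1
  exact List.append_cancel_left h1

theorem exists_between {s : ℕ → ℕ} (h0 : s 0 = 0) (hs : StrictMono s) (p : ℕ) :
    ∃ i, s i ≤ p ∧ p < s (i + 1) := by
  have hex : ∃ n, p < s n := ⟨p + 1, Nat.lt_of_succ_le hs.le_apply⟩
  obtain ⟨i, hi⟩ : ∃ i, Nat.find hex = i + 1 := Nat.exists_eq_succ_of_ne_zero fun h => by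
    have := Nat.find_spec hex
    rw [h, h0] at this
    omega
  exact ⟨i, not_lt.1 (Nat.find_min hex (by omega)), hi ▸ Nat.find_spec hex⟩

namespace Grammar

open RegTerm

variable {N : Type u} {A : Type v} {G : Grammar N A}

/-! ### The pivot path -/

/-- Pivots are chained into one path: `s n` is the position of the n-th pivot on the path, `t n` its
position on α. The two differ because a change of side follows an exposing word instead of α. -/
theorem Stuck.exists_pivot_path (hdet : G.IsDeterministic) {B : Set (G.Term × G.Term)}
    {T₀ U₀ : G.Term} {α : ℕ → A} {M : ℕ} (hs : G.Stuck B T₀ U₀ α)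
    (hB : ((var 0 : G.Term), (var 0 : G.Term)) ∈ B) (hM0 : 0 < M) (hM : G.ExposedWithin M)
    {d : ℕ} (hd : ∀ X a E, (X, a, E) ∈ G.rules → E.HeightLE d) :
    ∃ (β : ℕ → A) (Q : ℕ → G.Term) (s t : ℕ → ℕ), G.IsPath β Q ∧ s 0 = 0 ∧ StrictMono s ∧
      StrictMono t ∧ (∀ n, G.Pivot B T₀ U₀ α M (t n) (Q (s n))) ∧
      ∀ n p, s n + (M + (1 + M * d) * M) ≤ p → p + M ≤ s (n + 1) →
        G.Sinks (Q p) (seg β p M) := by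
  obtain ⟨k, T', U', hT', hU', hp, _⟩ := hs.exists_persists hdet hB (t := 0) .start M
  have hm := hs.models_seg hdet (t := 0) .start hT' hU'
  obtain ⟨W₀, h₀⟩ : ∃ W₀, G.Pivot B T₀ U₀ α M (0 + k) W₀ := by
    rcases hp with hp | hp
    · exact ⟨U', T', hm, hp⟩
    · exact ⟨T', U', hm.symmetry, hp⟩
  choose! t' W' V x y h1 h2 h3 h4 h5 h6 h7 using
    fun t W => hs.exists_next_pivot hdet hB hM0 hM hd (t := t) (W := W)
  let c : ℕ → ℕ × G.Term := fun n =>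
    Nat.rec (0 + k, W₀) (fun _ c => (t' c.1 c.2, W' c.1 c.2)) n
  have hc : ∀ n, G.Pivot B T₀ U₀ α M (c n).1 (c n).2 := by
    intro n
    induction n with
    | zero => exact h₀
    | succ n ih => exact h2 _ _ ih
  obtain ⟨β, s, hs0, hsm, hsv⟩ := exists_concat
    (fun n => x (c n).1 (c n).2 ++ y (c n).1 (c n).2) fun n => by simp [h3 _ _ (hc n)]
  have hstep : ∀ n, G.lts.Reach (c n).2 (seg β (s n) (s (n + 1) - s n)) (c (n + 1)).2 := by
    intro n
    rw [(hsv n).1, Nat.add_sub_cancel_left, (hsv n).2]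
    exact (LTS.reach_append _).2 ⟨_, h5 _ _ (hc n), h6 _ _ (hc n)⟩
  have hreach : ∀ n, G.lts.Reach W₀ (seg β 0 (s n)) (c n).2 := by
    intro n
    induction n with
    | zero => rw [hs0]; rfl
    | succ n ih =>
      have hle := hsm.monotone (Nat.le_succ n)
      rw [← Nat.add_sub_cancel' hle, seg_add, Nat.zero_add]
      exact (LTS.reach_append _).2 ⟨_, ih, hstep n⟩
  obtain ⟨Q, hQ0, hQ⟩ := exists_isPath hdet (β := β) (T := W₀) fun p => by
    have := hreach p
    rw [← Nat.add_sub_cancel' (hsm.le_apply (x := p)), seg_add] at this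
    obtain ⟨m, hm, _⟩ := (LTS.reach_append _).1 this
    exact ⟨m, hm⟩
  have hQs : ∀ n, Q (s n) = (c n).2 := fun n => by
    have := hQ.reach 0 (s n)
    rw [hQ0, Nat.zero_add] at this
    exact reach_det hdet this (hreach n)
  refine ⟨β, Q, s, fun n => (c n).1, hQ, hs0, hsm,
    strictMono_nat_of_lt_succ fun n => h1 _ _ (hc n), fun n => by rw [hQs]; exact hc n, ?_⟩
  intro n p hp1 hp2
  obtain ⟨hn1, hn2⟩ := hsv n
  obtain ⟨h8, h9, _⟩ := eq_seg_of_append hn2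
  have h10 := h4 _ _ (hc n)
  rw [List.length_append] at hn1
  generalize hxl : (x (c n).1 (c n).2).length = a at *
  generalize hyl : (y (c n).1 (c n).2).length = b at *
  have hV : Q (s n + a) = V (c n).1 (c n).2 := by
    have h11 := hQ.reach (s n) a
    rw [← h8, hQs] at h11
    exact reach_det hdet h11 (h5 _ _ (hc n))
  -- The bounded part `x` ends before `p`, and `p + M` does not pass the next pivot; the factor
  -- therefore lies inside the sinking part `y`.
  obtain ⟨l, rfl⟩ : ∃ l, p = s n + a + l := Nat.exists_eq_add_of_le (by omega)
  obtain ⟨r, rfl⟩ : ∃ r, b = l + (M + r) := Nat.exists_eq_add_of_le (by omega) |>.imp fun r hr =>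
    show b = l + (M + r) by omega
  refine h7 _ _ (hc n) (seg β (s n + a) l) (seg β (s n + a + l) M)
    (seg β (s n + a + l + M) r) _ ?_ (by simp) (hV ▸ hQ.reach (s n + a) l)
  rw [h9, seg_add, seg_add]

/-! ### Stairs -/

/-- A term of height `h` disappears within `(h + 1) * M` steps if it sinks every `M` steps. -/
theorem le_of_sinks (hdet : G.IsDeterministic) {β : ℕ → A} {Q : ℕ → G.Term}
    (hQ : G.IsPath β Q) {M : ℕ} {σ : ℕ → G.Term} {h : ℕ} :
    ∀ {L L' : G.Term} {r k : ℕ}, L.HeightLE h → Q r = L.subst σ →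
      G.lts.Reach L (seg β r k) L' →
      (∀ l, l + M ≤ k → G.Sinks (Q (r + l)) (seg β (r + l) M)) → k ≤ (h + 1) * M := by
  -- Since the path sinks and `L` is not yet used up, the sinking step descends to a child of `L` in
  -- fewer than M steps.
  have key : ∀ {L L' : G.Term} {r k : ℕ}, M < k → Q r = L.subst σ →
      G.lts.Reach L (seg β r k) L' →
      (∀ l, l + M ≤ k → G.Sinks (Q (r + l)) (seg β (r + l) M)) →
      ∃ X q i, L.label [] = some (Sum.inl X) ∧ i < G.arity X ∧ q < M ∧
        Q (r + q) = (L.child i).subst σ ∧ G.lts.Reach (L.child i) (seg β (r + q) (k - q)) L' := by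
    intro L L' r k hk hr hL hsink
    rcases L.exists_label_nil with ⟨j, rfl⟩ | ⟨X, hX⟩
    · have := congrArg List.length (reach_var hL).1
      rw [seg_length, List.length_nil] at this
      omega
    · obtain ⟨Y, q, i, hY, _, hq, hi, hc⟩ := (hsink 0 (by omega)).exists_child hdet hQ
      obtain rfl : X = Y := by
        rw [Nat.add_zero, hr, subst_label_nil hX] at hY
        simpa using hY
      have hiX := lt_arity_of_reach hi
      refine ⟨X, q, i, hX, hiX, hq, ?_, ?_⟩
      · rw [Nat.add_zero] at hc
        rw [hc, hr, child_subst hX _ hiX]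
      · rw [← Nat.add_sub_cancel' (show q ≤ k by omega), seg_add] at hL
        exact reach_of_append hdet (reach_child hX hi) hL
  induction h with
  | zero =>
    intro L L' r k hL hr hr' hsink
    by_contra hk
    obtain ⟨X, q, i, hX, hi, _⟩ := key (by omega) hr hr' hsink
    exact not_heightLE_zero hX hi hL
  | succ h ih =>
    intro L L' r k hL hr hr' hsink
    by_contra hk
    have hM : (h + 1 + 1) * M = (h + 1) * M + M := by ring
    obtain ⟨X, q, i, hX, hi, hq, h1, h2⟩ := key (by
      have := Nat.zero_le ((h + 1) * M)
      omega) hr hr' hsink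
    have := ih (hL.child hX hi) h1 h2 fun l hl => by
      rw [Nat.add_assoc]
      exact hsink _ (by omega)
    omega

/-- A bound for the distance to the next pivot at distance `e` from a stair. -/
def pivotBound (M d c e : ℕ) : ℕ := e + c + (1 + (e + c) * d + 1) * M

/-- After `e + c` steps the context grown on the root has height at most `1 + (e + c) * d`. From
then on the path sinks, so persisting longer than `le_of_sinks` allows would exhaust this context
and lose the root. -/
theorem le_pivotBound (hdet : G.IsDeterministic) {β : ℕ → A} {Q : ℕ → G.Term}
    (hQ : G.IsPath β Q) {M d c e p k : ℕ}
    (hd : ∀ X a E, (X, a, E) ∈ G.rules → E.HeightLE d)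
    (hp : G.Persists (Q p) (seg β p k))
    (hsink : ∀ q, p + e + c ≤ q → q + M ≤ p + k → G.Sinks (Q q) (seg β q M)) :
    k ≤ pivotBound M d c e := by
  unfold pivotBound
  by_contra hk
  obtain ⟨l, rfl⟩ : ∃ l, k = e + c + l := Nat.exists_eq_add_of_le (by omega)
  obtain ⟨X, E, hX, hE⟩ := hp
  rw [seg_add] at hE
  obtain ⟨L, h1, h2⟩ := (LTS.reach_append _).1 hE
  have h3 : Q (p + (e + c)) = L.subst (Q p).child := by
    have h4 := reach_subst h1 (Q p).child
    rw [← eq_flat_subst hX] at h4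
    exact reach_det hdet (hQ.reach p (e + c)) h4
  have h4 : L.HeightLE (1 + (e + c) * d) := by
    simpa using reach_heightLE hd h1 (flat_heightLE X)
  have := le_of_sinks hdet hQ (M := M) h4 h3 h2 fun l' hl' => hsink _ (by omega) (by omega)
  omega

/-- A bound for the distance from a stair to the `j`-th pivot after it. -/
def stairBound (M d c : ℕ) : ℕ → ℕ
  | 0 => pivotBound M d c 0
  | j + 1 => pivotBound M d c (stairBound M d c j)

theorem stairBound_zero_le (M d c j : ℕ) : stairBound M d c 0 ≤ stairBound M d c j := by
  induction j with
  | zero => exact le_rfl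
  | succ j ih =>
    refine ih.trans ?_
    rw [stairBound.eq_2, pivotBound]
    omega

/-- A path on which infinitely many positions are marked, such that it keeps sinking between
consecutive marks, has infinitely many marks close to occurrences of the same root. -/
theorem exists_stair (hdet : G.IsDeterministic) {β : ℕ → A} {Q : ℕ → G.Term}
    (hQ : G.IsPath β Q) (hg : ∀ p, (Q p).IsGround) {M d c : ℕ}
    (hd : ∀ X a E, (X, a, E) ∈ G.rules → E.HeightLE d)
    {s : ℕ → ℕ} (hs0 : s 0 = 0) (hs : StrictMono s)
    (hsink : ∀ n p, s n + c ≤ p → p + M ≤ s (n + 1) → G.Sinks (Q p) (seg β p M)) :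
    ∃ (V : G.Term) (ι : ℕ → ℕ), V.IsGround ∧ StrictMono ι ∧ ∀ j, ∃ p k, Q p = V ∧
      s (ι j) = p + k ∧ k ≤ stairBound M d c j ∧ G.Persists (Q p) (seg β p k) := by
  -- If some position never loses its root, its term serves as V for all later marks; each mark is
  -- bounded from the distance of the preceding one.
  by_cases hstair : ∃ p, ∀ k, G.Persists (Q p) (seg β p k)
  · obtain ⟨p, hp⟩ := hstair
    obtain ⟨i, hi1, hi2⟩ := exists_between hs0 hs p
    have hb : ∀ j, ∃ k, s (i + 1 + j) = p + k ∧ k ≤ stairBound M d c j := by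
      intro j
      induction j with
      | zero =>
        obtain ⟨k, hk⟩ := Nat.exists_eq_add_of_le hi2.le
        exact ⟨k, hk, le_pivotBound hdet hQ hd (hp k) fun q h1 h2 =>
          hsink i q (by omega) (by omega)⟩
      | succ j ih =>
        obtain ⟨k, hk, hkb⟩ := ih
        obtain ⟨l, hl⟩ := Nat.exists_eq_add_of_le
          (hs.monotone (Nat.le_add_right (i + 1 + j) 1))
        refine ⟨k + l, by rw [← Nat.add_assoc, ← Nat.add_assoc, ← hk]; exact hl, ?_⟩
        exact le_pivotBound hdet hQ hd (hp _) fun q h1 h2 =>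
          hsink (i + 1 + j) q (by omega) (by omega)
    refine ⟨Q p, fun j => i + 1 + j, hg p, fun a b h => Nat.add_lt_add_left h _, fun j => ?_⟩
    obtain ⟨k, hk, hkb⟩ := hb j
    exact ⟨p, k, rfl, hk, hkb, hp k⟩
  · push Not at hstair
    -- Otherwise every position is followed by a later one where a child of its term is exposed; up
    -- to there the root persists.
    have hnext : ∀ p, ∃ q, 0 < q ∧ (∃ i, Q (p + q) = (Q p).child i) ∧
        ∀ k ≤ q, G.Persists (Q p) (seg β p k) := by
      intro p
      obtain ⟨k, hk⟩ := hstair p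
      obtain ⟨X, hX⟩ := (hg p).exists_label_nil
      obtain ⟨Y, q, i, hY, hq, _, hi, hc⟩ :=
        ((persists_or_sinks hX (hQ.reach p k)).resolve_left hk).exists_child hdet hQ
      refine ⟨q, hq, ⟨i, hc⟩, fun l hl => ?_⟩
      rw [← Nat.add_sub_cancel' hl, seg_add] at hi
      obtain ⟨L, hL, _⟩ := (LTS.reach_append _).1 hi
      exact ⟨Y, L, hY, hL⟩
    choose nx hnx0 hnxc hnxp using hnext
    let pp : ℕ → ℕ := fun n => Nat.rec 0 (fun _ p => p + nx p) n
    have hpps : ∀ n, pp (n + 1) = pp n + nx (pp n) := fun n => rfl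
    have hpp : StrictMono pp := strictMono_nat_of_lt_succ fun n => by
      have := hnx0 (pp n)
      rw [hpps]
      omega
    have hsub : ∀ n, Q (pp n) ∈ (Q 0).subterms := by
      intro n
      induction n with
      | zero => exact self_mem_subterms _
      | succ n ih =>
        obtain ⟨i, hi⟩ := hnxc (pp n)
        rw [hpps, hi]
        exact child_mem_subterms ih i
    let good : G.Term → ℕ → Prop := fun V n => ∃ p k, Q p = V ∧ s n = p + k ∧
      k ≤ stairBound M d c 0 ∧ G.Persists (Q p) (seg β p k)
    have hgood : ∀ m, ∃ n > m, ∃ V ∈ (Q 0).subterms, good V n := by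
      intro m
      -- `pp k` is the last descent position not after the mark `s (i + 1)`, and it is not before `s
      -- i`, so the path sinks between them after the first `c` steps. Starting from `pp (s m)`,
      -- which is at least `s m`, makes the mark later than the m-th.
      obtain ⟨i, hi1, hi2⟩ := exists_between hs0 hs (pp (s m))
      obtain ⟨k, hk1, hk2⟩ := exists_between (s := pp) rfl hpp (s (i + 1))
      have hmk : s m ≤ k := by
        by_contra hlt
        have h1 : pp (k + 1) ≤ pp (s m) := hpp.monotone (show k + 1 ≤ s m by omega)
        omega
      have hmk' := hpp.monotone hmk
      have hm : s m < s (i + 1) := lt_of_le_of_lt (hpp.le_apply (x := s m)) hi2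
      obtain ⟨l, hl⟩ := Nat.exists_eq_add_of_le hk1
      have hpers : G.Persists (Q (pp k)) (seg β (pp k) l) := hnxp _ _ (by
        rw [hpps] at hk2
        omega)
      refine ⟨i + 1, hs.lt_iff_lt.1 hm, Q (pp k), hsub k, pp k, l, rfl, hl, ?_, hpers⟩
      exact le_pivotBound hdet hQ hd hpers fun q h1 h2 => hsink i q (by omega) (by omega)
    -- Pigeonhole over the finitely many subterms of the first term.
    obtain ⟨V, hV, hVinf⟩ : ∃ V ∈ (Q 0).subterms, ∀ m, ∃ n > m, good V n := by
      by_contra hc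
      push Not at hc
      choose! m hm using hc
      obtain ⟨m', hm'⟩ := ((Q 0).subterms_finite.image m).bddAbove
      obtain ⟨n, hn, V, hV, hVn⟩ := hgood m'
      exact hm V hV n (lt_of_le_of_lt (hm' ⟨V, hV, rfl⟩) hn) hVn
    obtain ⟨ι, hι, hιg⟩ := Nat.exists_strictMono_subsequence hVinf
    refine ⟨V, ι, ?_, hι, fun j => ?_⟩
    · obtain ⟨p, _, hp, _⟩ := hιg 0
      exact hp ▸ hg p
    · obtain ⟨p, k, h1, h2, h3, h4⟩ := hιg j
      exact ⟨p, k, h1, h2, h3.trans (stairBound_zero_le M d c j), h4⟩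

/-! ### The sufficient basis -/

/-- The pairs that balancing produces from a pivot reachable from `P` by a short word. -/
def balancedPairs (G : Grammar N A) (M k : ℕ) (P : G.Term) : Set (G.Term × G.Term) :=
  Set.range fun p : (Σ X : N, G.reachSet M (flat X) × (Fin (G.arity X) → G.reachSet k P)) ×
      G.reachSet k P =>
    ((p.1.2.1 : G.Term).subst
      (fun j => if h : j < G.arity p.1.1 then (p.1.2.2 ⟨j, h⟩ : G.Term) else P), p.2)

theorem balancedPairs_finite [Finite N] (M k : ℕ) (P : G.Term) :
    (G.balancedPairs M k P).Finite := by
  have := (G.reachSet_finite k P).to_subtype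
  have : ∀ X : N, Finite (G.reachSet M (flat X)) := fun X =>
    (G.reachSet_finite M (flat X)).to_subtype
  exact Set.finite_range _

theorem balancedPairs_varsIn {M k : ℕ} {P : G.Term} {D : Set ℕ} (hP : P.VarsIn D) :
    ∀ p ∈ G.balancedPairs M k P, p.1.VarsIn D ∧ p.2.VarsIn D := by
  have hreach : ∀ T : G.reachSet k P, (T : G.Term).VarsIn D := by
    rintro ⟨T, w, _, hw⟩
    exact reach_varsIn hw hP
  rintro _ ⟨⟨⟨X, E, f⟩, F⟩, rfl⟩
  refine ⟨VarsIn.subst (D := Set.univ) (fun _ _ _ => trivial) fun j _ => ?_, hreach F⟩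
  split_ifs
  exacts [hreach _, hP]

/-- Balancing runs words of at most M letters from the pivot `Lτ`. The variables of `L` lie at depth
at least M, so these runs never look inside τ and can be performed on `L`, hence from `P`. -/
theorem Stuck.exists_balancedPair (hdet : G.IsDeterministic) {B : Set (G.Term × G.Term)}
    {T₀ U₀ : G.Term} {α : ℕ → A} {M : ℕ} (hs : G.Stuck B T₀ U₀ α) (hM : G.ExposedWithin M)
    {P L W : G.Term} {τ : ℕ → G.Term} {x : List A} {t k : ℕ} (hxk : x.length ≤ k)
    (hx : G.lts.Reach P x L) (hL : L.DepthGE M) (hW : W = L.subst τ)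
    (h : G.Pivot B T₀ U₀ α M t W) :
    ∃ p ∈ G.balancedPairs M (k + M) P,
      G.Models B T₀ U₀ (seg α 0 (t + M)) (.pair (p.1.subst τ) (p.2.subst τ)) := by
  obtain ⟨X, E, W', ρ, hE, hW', hρ, hρ', hm⟩ := hs.exists_balanced hdet hM h
  have hmem : ∀ {w : List A} {V : G.Term}, w.length ≤ M → G.lts.Reach W w V →
      ∃ F : G.reachSet (k + M) P, V = (F : G.Term).subst τ := by
    intro w V hw hV
    rw [hW] at hV
    obtain ⟨F, hF, hF'⟩ := reach_subst_inv_of_depthGE (hL.mono hw) hV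
    exact ⟨⟨F, x ++ w, by rw [List.length_append]; omega,
      (LTS.reach_append _).2 ⟨L, hx, hF⟩⟩, hF'⟩
  obtain ⟨F, hF⟩ := hmem (by simp) hW'
  have key : ∀ j : Fin (G.arity X), ∃ F : G.reachSet (k + M) P, ρ j = (F : G.Term).subst τ := by
    intro j
    obtain ⟨w, _, hw, hwr⟩ := hρ' j j.2
    exact hmem hw.le hwr
  choose f hf using key
  refine ⟨_, ⟨⟨⟨X, ⟨E, _, by simp, hE⟩, f⟩, F⟩, rfl⟩, ?_⟩
  rw [hF] at hm
  have hEρ : E.subst ρ = (E.subst fun j =>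
      if h : j < G.arity X then (f ⟨j, h⟩ : G.Term) else P).subst τ := by
    rw [subst_subst]
    refine subst_congr (D := {j | j < G.arity X}) (reach_varsIn hE (flat_varsIn X)) fun j hj => ?_
    have hj' : j < G.arity X := hj
    simpa only [dif_pos hj'] using hf ⟨j, hj'⟩
  rw [hEρ] at hm
  exact hm

theorem exists_isSufficientBasis [Finite N] (hdet : G.IsDeterministic)
    (hnf : G.IsNormalForm) : ∃ B : Set (G.Term × G.Term), G.IsSufficientBasis B := by
  obtain ⟨M, hM0, hM⟩ := exists_exposedWithin hnf
  obtain ⟨d, hd⟩ := G.exists_rhs_height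
  -- One level more than the M needed for balancing: the pivots lie above the root successors of V,
  -- and these are cut one level less deep.
  obtain ⟨𝓟, hfin, hdepth, hcut⟩ := exists_cut (ar := G.arity) (M + 1)
  let K : ℕ → ℕ := stairBound M d (M + (1 + M * d) * M)
  have hbasis : ∀ P : G.Term, ∃ B : Set (G.Term × G.Term), B.Finite ∧ G.IsSound B ∧
      G.Covers B fun j => G.balancedPairs M (K j + M) P := by
    intro P
    obtain ⟨D, hD, hPD⟩ := P.exists_finite_varsIn
    exact exists_sound_covers hdet hD.toFinset _ (fun j => balancedPairs_finite _ _ _)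
      fun j => balancedPairs_varsIn (by simpa using hPD)
  choose B hBfin hBsound hBcov using hbasis
  have := hfin.to_subtype
  refine ⟨insert (var 0, var 0) (⋃ P : 𝓟, B P),
    (Set.finite_iUnion fun P : 𝓟 => hBfin P).insert _, Set.mem_insert _ _, ?_, ?_⟩
  · rintro _ ⟨E, F, hEF, σ, hσ, rfl⟩
    rcases hEF with hEF | hEF
    · obtain ⟨rfl, rfl⟩ := Prod.mk.injEq _ _ _ _ ▸ hEF
      rfl
    · exact IsSound.iUnion (fun P : 𝓟 => hBsound P) _ ⟨E, F, hEF, σ, hσ, rfl⟩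
  · intro T₀ U₀ hT hU h0
    by_contra hns
    obtain ⟨α, hs⟩ := exists_stuck hdet h0 hT hU hns
    obtain ⟨β, Q, s, t, hQ, hs0, hsm, htm, hpiv, hsink⟩ :=
      hs.exists_pivot_path hdet (Set.mem_insert _ _) hM0 hM hd
    have hQg : ∀ p, (Q p).IsGround := by
      intro p
      obtain ⟨Z, hZ, _⟩ := hpiv 0
      have := (hZ.isGround hT hU).2
      rw [hs0] at this
      exact reach_isGround (by simpa using hQ.reach 0 p) this
    obtain ⟨V, ι, hV, hι, hj⟩ := exists_stair hdet hQ hQg hd hs0 hsm hsink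
    obtain ⟨P, hP, τ, hτ, rfl⟩ := hcut V hV
    obtain ⟨X, hX⟩ := (hdepth P hP).exists_label_nil
    -- The whole basis is used as the set of derivation, while the pair found lies in the part that
    -- belongs to `P`. Adding M to all lengths keeps them increasing and makes the word of the final
    -- basis rule nonempty.
    obtain ⟨j, q, hq, hm⟩ := hBcov P _ T₀ U₀ h0 τ hτ (fun j => seg α 0 (t (ι j) + M))
      (fun a b hab => by
        have := htm (hι hab)
        simp only [seg_length]
        omega)
      (fun j => by
        obtain ⟨p, k, hp, hk, hkb, Y, E, hY, hE⟩ := hj j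
        obtain rfl : X = Y := by
          rw [hp, subst_label_nil hX] at hY
          simpa using hY
        have h1 : G.lts.Reach P (seg β p k) (E.subst P.child) := by
          have := reach_subst hE P.child
          rwa [← eq_flat_subst hX] at this
        refine hs.exists_balancedPair hdet hM (by simpa using hkb) h1
          (DepthGE.subst (reach_varsIn hE (flat_varsIn X)) fun i _ => (hdepth P hP).child i)
          (W := Q (s (ι j))) ?_ (hpiv _)
        rw [hk]
        refine reach_det hdet (hQ.reach p k) ?_
        rw [hp]
        exact reach_subst h1 τ)
    refine hs.not_success _ (.basis ?_ hm ⟨q.1, q.2,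
      Or.inr (Set.mem_iUnion.2 ⟨⟨P, hP⟩, hq⟩), τ, hτ, rfl⟩)
    intro h
    have := congrArg List.length h
    rw [seg_length, List.length_nil] at this
    omega

end Grammar
end FOG

theorem mainTheorem2 {N : Type*} {A : Type*} [Finite N] [Finite A] (G : FOG.Grammar N A)
    (hdet : G.IsDeterministic) (hnf : G.IsNormalForm) :
    ∃ B : Set (G.Term × G.Term), G.IsSufficientBasis B :=
  FOG.Grammar.exists_isSufficientBasis hdet hnf
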